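/- **Syntax.** Fix an integer $n\ge 1$, a countable set $\mathcal N$ of names, a set $IAct$ of internal actions with a distinguished silent action $\tau$, a set $Y$ of procedure variables. Joint inputs are $j::=c\mid j\,\&\,j$ with at most $n$ names; elementary actions are $a::=b\mid\bar c\mid j\mid\mathsf{stop}$ ($b\in IAct$, $c\in\mathcal N$); statements are $x::=a\mid y\mid x\backslash c\mid x;x\mid x+x\mid x\parallel x\mid x\,|\,x\mid x\lfloor\!\lfloor x\mid x\lfloor x$; guarded statements are $g::=a\mid g\backslash c\mid g;x\mid g+g\mid g\parallel g\mid g\,|\,g\mid g\lfloor\!\lfloor x\mid g\lfloor g$. Fix a declaration, i.e. a map sending each $y\in Y$ to a guarded statement $D(y)$. **Identifiers.** $Id$ is given by $\alpha::=\bullet\mid(;\bullet)\mid(\alpha;)\mid(\alpha\backslash c)\mid(\alpha\parallel)\mid(\parallel\alpha)$; $\alpha(\beta)$, also written $\alpha\beta$, denotes substitution of $\beta$ for the hole $\bullet$ (with $(;\bullet)(\beta)=(;\bullet)$); $\le$ is the prefix order ($\bullet\le\alpha$ for all $\alpha$, and all the other constructors, $(;\bullet)$ included, must match). $\alpha\wedge\beta$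 is the greatest lower bound of $\alpha,\beta$, and $\alpha\ominus\beta$ (for $\beta\le\alpha$) is the rest of $\alpha$ after the common part with $\beta$ has been removed ($\alpha\ominus\bullet=\alpha$). For a finite $\pi\subseteq Id$ let $\pi_{|\alpha}=\{\beta\in\pi\mid\alpha\le\beta\}$, and let $\pi_{\|\alpha}$ be the set of the names $c$ such that some $\beta\in\pi$ satisfies $\beta\ge\alpha(\bullet\backslash c)$ with the name $c$ placed at the hole of $\alpha$. Let $U$ be the set of sets of at most $n+1$ pairs $a@\alpha$ with $a$ an action and $\alpha\in Id$, and $Ids$ the set of sequences of identifiers of length between $1$ and $n+1$. Let $\iota_2(c_1@\alpha_1,c_2@\alpha_2)$ mean that $\alpha_1\ne\alpha_2$, $c_1=c_2$, and $c_i$ is not restricted in $\alpha_i\ominus(\alpha_1\wedge\alpha_2)$ for $i=1,2$. The interaction function $\iota$ on finite sets of such pairs is: $\iota(\{b@\alpha\})=b$; $\iota(u)=\tau$ if $u=\{\bar c_1@\alpha_1,\dots,\bar c_m@\alpha_m,(c_1\&\cdots\&c_m)@\alpha\}$, with distinct elements, and $\iota_2(c_i@\alpha_i,c_i@\alpha)$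 for all $i$; otherwise $\iota(u)=\uparrow$. **Domains.** Let $Q_D$ be the space of finite and infinite sequences over $IAct$ with distance $2^{-k}$, $k$ the first index where they differ, and let $P_D$ be the space of nonempty compact subsets of $Q_D$ with the Hausdorff metric. Let $D$ be any complete ultrametric space with distances at most $1$ and with an isometry $$D\cong Cont\xrightarrow{1}P_D,\qquad Cont=\Big(\sum_{i=0}^n(\tfrac12 D)^i\Big)\times U\times Ids\times K,\qquad K=\mathcal P_{fin}(Id)\times(Id\to Den),\qquad Den=\{\phi_E\}+\tfrac12D,$$ where $\xrightarrow1$ denotes nonexpansive maps with the supremum metric, sets carry the discrete metric, products and function spaces the maximum (supremum) metric, and different summands have distance $1$. Elements of $Cont$ are written $(\varphi,u,\langle\alpha:\mu\mid\kappa\rangle)$; $\kappa[\alpha\mapsto\phi]$ adds $\alpha$ to the first component of $\kappa$ and changes the value at $\alpha$ to $\phi$. Let $\gamma_0=((),\emptyset,\langle(\bullet)\mid(\emptyset,\lambda\alpha.\phi_E)\rangle)$. **Operators.** Let $card_u(\gamma)=|u|$ and $card_\gamma(\gamma)\iff len(\varphi)+|u|<n$ for $\gamma=(\varphi,u,\langle\alpha:\mu\mid\kappa\rangle)$;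 exponents $n-|u|$ are truncated at $0$. For such $\gamma$ put - $\gamma\,\tilde\backslash\,c=(\varphi,u,\langle\alpha(\bullet\backslash c):\mu\mid\kappa\rangle)$, - $add_;(\phi,\gamma)=(\varphi,u,\langle\alpha(\bullet;):\mu\mid\kappa[\alpha(;\bullet)\mapsto\phi]\rangle)$, - $add_{\lfloor\!\lfloor}(\phi,\gamma)=(\varphi,u,\langle\alpha(\bullet\parallel):\mu\mid\kappa[\alpha(\parallel\bullet)\mapsto\phi]\rangle)$, - $add_\lfloor(\phi,\gamma)=(\phi:\varphi,u,\langle\alpha(\bullet\parallel):\alpha(\parallel\bullet):\mu\mid\kappa\rangle)$ if $card_\gamma(\gamma)$ holds and $\alpha:\mu$ has length at most $n$; otherwise, where $add_\lfloor$ is not used or the value need not be in $Cont$, $add_\lfloor(\phi,\gamma)=\gamma$. For $p_1,p_2\in P_D$ let $\bar p=\{q\in p_1\cup p_2\mid q=\tau^{n-i}\bar q,\ \bar q\neq\epsilon\}$, and let $p_1\uplus_ip_2$ be $\bar p$ if $\bar p\ne\emptyset$ and $\{\tau^{n-i}\}$ otherwise. On $D$ put $(\phi\backslash c)(\gamma)=\phi(\gamma\,\tilde\backslash\,c)$,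 $(\phi_1;\phi_2)(\gamma)=\phi_1(add_;(\phi_2,\gamma))$, $(\phi_1\lfloor\!\lfloor\phi_2)(\gamma)=\phi_1(add_{\lfloor\!\lfloor}(\phi_2,\gamma))$, $(\phi_1\oplus\phi_2)(\gamma)=\phi_1(\gamma)\uplus_{card_u(\gamma)}\phi_2(\gamma)$; $(\phi_1\lfloor\phi_2)(\gamma)=\phi_1(add_\lfloor(\phi_2,\gamma))$ if $card_\gamma(\gamma)$ and $\{\tau^{n-|u|}\}$ otherwise; $\phi_1|\phi_2=(\phi_1\lfloor\phi_2)\oplus(\phi_2\lfloor\phi_1)$; $\phi_1\parallel\phi_2=(\phi_1\lfloor\!\lfloor\phi_2)\oplus(\phi_2\lfloor\!\lfloor\phi_1)\oplus(\phi_1|\phi_2)$. The operators $\hat\backslash,\hat;,\hat\parallel$ on $Den$ extend $\backslash,;,\parallel$ by $\phi_E\hat\backslash c=\phi_E$ and by making $\phi_E$ neutral. For $\kappa=(\pi,\theta)$, $kd(\alpha,\kappa)$ is: $\phi_E$ if $\pi_{|\alpha}=\emptyset$; else $\theta(\alpha)$ if $\pi_{|\alpha}=\{\alpha\}$; else $kd(\alpha(\bullet\backslash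 c),\kappa)\,\hat\backslash\,c$ if $\pi_{\|\alpha}=\{c\}$; else $kd(\alpha(\bullet;),\kappa)\,\hat;\,\theta(\alpha(;\bullet))$ if $\alpha(;\bullet)\in\pi$; else $kd(\alpha(\bullet\parallel),\kappa)\,\hat\parallel\,kd(\alpha(\parallel\bullet),\kappa)$. Finally $op_A(a)((),u,\langle(\alpha)\mid\kappa\rangle)$ is, if $|u|\le n$ and $\iota(\{a@\alpha\}\cup u)=b\in IAct$: $\{\tau^{n-|u|}b\}$ when $kd(\bullet,\kappa)=\phi_E$, and $\tau^{n-|u|}\cdot b\cdot\phi(\gamma_0)$ when $kd(\bullet,\kappa)=\phi\in D$; and $op_A(a)(\phi:\varphi,u,\langle\alpha:\mu\mid\kappa\rangle)=\tau\cdot\phi(\varphi,\{a@\alpha\}\cup u,\langle\mu\mid\kappa\rangle)$ if $|u|\le n$ and $\mu$ is nonempty; in all other cases $op_A(a)(\gamma)=\{\tau^{n-|u|}\}$. **Semantics.** $\mathcal D:Stmt\to D$ is the unique fixed point of the map $\Psi$ with $\Psi(S)(a)=op_A(a)$, $\Psi(S)(y)=\Psi(S)(D(y))$, $\Psi(S)(x\backslash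 c)=\Psi(S)(x)\backslash c$, $\Psi(S)(x_1;x_2)=\Psi(S)(x_1);S(x_2)$, $\Psi(S)(x_1+x_2)=\Psi(S)(x_1)\oplus\Psi(S)(x_2)$, $\Psi(S)(x_1\lfloor\!\lfloor x_2)=\Psi(S)(x_1)\lfloor\!\lfloor S(x_2)$, $\Psi(S)(x_1\lfloor x_2)=\Psi(S)(x_1)\lfloor\Psi(S)(x_2)$, $\Psi(S)(x_1|x_2)=(\Psi(S)(x_1)\lfloor\Psi(S)(x_2))\oplus(\Psi(S)(x_2)\lfloor\Psi(S)(x_1))$, and $\Psi(S)(x_1\parallel x_2)=(\Psi(S)(x_1)\lfloor\!\lfloor S(x_2))\oplus(\Psi(S)(x_2)\lfloor\!\lfloor S(x_1))\oplus(\Psi(S)(x_1)\lfloor\Psi(S)(x_2))\oplus(\Psi(S)(x_2)\lfloor\Psi(S)(x_1))$. Let $D^{\mathcal D}=\{\mathcal D(x)\mid x\in Stmt\}$. **Resumptions.** Let $k$ range over $\mathcal P_{fin}(Id)\times(Id\to\{E\}\cup Stmt)$ and $f$ over sequences of at most $n$ statements. $Res$ is the least set of elements $(f,u,\langle\alpha:\mu\mid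 k\rangle)$ with $u\in U$, $\alpha:\mu\in Ids$ such that $((),\emptyset,\langle(\bullet)\mid(\emptyset,\lambda\alpha.E)\rangle)\in Res$ and such that, if $x\in Stmt$, $c\in\mathcal N$ and $(f,u,\langle\alpha:\mu\mid k\rangle)\in Res$, then $Res$ contains - $(f,u,\langle\alpha(\bullet\backslash c):\mu\mid k\rangle)$, - $(f,u,\langle\alpha(\bullet;):\mu\mid k[\alpha(;\bullet)\mapsto x]\rangle)$, - $(f,u,\langle\alpha(\bullet\parallel):\mu\mid k[\alpha(\parallel\bullet)\mapsto x]\rangle)$, - $(x:f,u,\langle\alpha(\bullet\parallel):\alpha(\parallel\bullet):\mu\mid k\rangle)$ if $len(f)+|u|<n$, - $(f',\{a@\alpha\}\cup u,\langle\mu\mid k\rangle)$ for every elementary action $a$, if $f=x':f'$ with $x'\in Stmt$, and $|u|\le n$. The continuation $sem(f,u,\langle\alpha:\mu\mid k\rangle)$ is obtained by replacing in $f$ and $k$ every statement $x$ by $\mathcal D(x)$ and $E$ by $\phi_E$. Let $Cont^{\mathcal D}=\{sem(\varrho)\mid\varrho\in Res\}$. **Invariance.** Argument types are built from metric domains $M$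 not depending on $D$, $Cont$, from $D$ and from $Cont$ by products, sums, $B\to t$ ($B$ a set), compact and nonempty compact powerdomains, and scaling by $\frac12$. For an argument type $t$, let $t(D^{\mathcal D},Cont^{\mathcal D})$ be the subset obtained by replacing $D$ by $D^{\mathcal D}$ and $Cont$ by $Cont^{\mathcal D}$. $Cont^{\mathcal D}$ is invariant under $h:t_1\to t_2$ if $h$ is nonexpansive and maps $t_1(D^{\mathcal D},Cont^{\mathcal D})$ into $t_2(D^{\mathcal D},Cont^{\mathcal D})$. **Lemma.** $Cont^{\mathcal D}$ is a class of denotable continuations for $\mathcal D$: it is invariant under every operator used in the definition of $\mathcal D$, that is, under $\tilde\backslash:Cont\times\mathcal N\to Cont$; $add_;,add_{\lfloor\!\lfloor},add_\lfloor:D\times Cont\to Cont$; $\backslash:D\times\mathcal N\to D$; $;,\oplus,\parallel,\lfloor\!\lfloor,\lfloor,|:D\times D\to D$; $\uplus_i:P_D\times P_D\to P_D$ for $0\le i\le n$; $\hat\backslash:Den\times\mathcal N\to Den$; $\hat;,\hat\parallel:Den\times Den\to Den$; $kd:Id\times K\to Den$; $card_u:Cont\to\mathbb N$; $card_\gamma:Cont\to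 Bool$; $op_A:Act\times Cont\to P_D$. Moreover, if $\gamma\in Cont^{\mathcal D}$ satisfies $card_\gamma(\gamma)$, then its sequence of identifiers has length at most $n$, so that $add_\lfloor(\phi,\gamma)$ is given by the formula $(\phi:\varphi,u,\langle\alpha(\bullet\parallel):\alpha(\parallel\bullet):\mu\mid\kappa\rangle)$. -/

import Mathlib

open scoped UniformConvergence
open TopologicalSpace

universe u

namespace CCSn

/-! ## Metric domains

All the spaces are ultrametric spaces with distances in `[0, 1]`. -/

/-- Ultrametric spaces with distances in `[0, 1]`. -/
class UMet (X : Type u) [MetricSpace X] : Prop where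
  ultra : ∀ x y z : X, dist x z ≤ max (dist x y) (dist y z)
  le_one : ∀ x y : X, dist x y ≤ 1

instance (priority := 100) UMet.bounded {X : Type u} [MetricSpace X] [UMet X] : BoundedSpace X :=
  Metric.boundedSpace_iff.2 ⟨1, UMet.le_one⟩

/-- A metric space from an ultrametric distance function. -/
abbrev MetricSpace.ofUltra {X : Type u} (d : X → X → ℝ) (h0 : ∀ x, d x x = 0)
    (he : ∀ x y, d x y = 0 → x = y) (hc : ∀ x y, d x y = d y x)
    (hu : ∀ x y z, d x z ≤ max (d x y) (d y z)) : MetricSpace X :=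
  have hn : ∀ x y, 0 ≤ d x y := fun x y => by simpa [h0, hc y x] using hu x y x
  { dist := d
    dist_self := h0
    dist_comm := hc
    dist_triangle := fun x y z => (hu x y z).trans (max_le_add_of_nonneg (hn x y) (hn y z))
    eq_of_dist_eq_zero := fun {x y} h => he x y h }

/-- A set with the discrete metric. -/
@[ext] structure Disc (X : Type u) where
  val : X

open Classical in
noncomputable instance (X : Type u) : MetricSpace (Disc X) :=
  MetricSpace.ofUltra (fun x y => if x = y then 0 else 1) (by simp)
    (fun x y => by by_cases h : x = y <;> simp [h])
    (fun x y => by simp [eq_comm])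
    (fun x y z => by
      by_cases h : x = y <;> by_cases h' : y = z <;> by_cases h'' : x = z <;> simp_all)

open Classical in
theorem Disc.dist_def {X : Type u} (x y : Disc X) : dist x y = if x = y then 0 else 1 := rfl

instance (X : Type u) : UMet (Disc X) where
  ultra x y z := by
    simp only [Disc.dist_def]
    by_cases h : x = y <;> by_cases h' : y = z <;> by_cases h'' : x = z <;> simp_all
  le_one x y := by
    simp only [Disc.dist_def]; split_ifs <;> norm_num

instance (X : Type u) : CompleteSpace (Disc X) := by
  refine Metric.complete_of_convergent_controlled_sequences (fun n => (1 / 2) ^ n) (by simp) ?_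
  intro v hv
  refine ⟨v 0, Metric.tendsto_atTop.2 fun ε hε => ⟨0, fun m _ => ?_⟩⟩
  have h : dist (v 0) (v m) < 1 := by simpa using hv 0 0 m le_rfl (Nat.zero_le m)
  have e : v 0 = v m := by
    by_contra hne
    simp [Disc.dist_def, hne] at h
  rwa [e, dist_self]

theorem Disc.eq_of_dist_lt {X : Type u} {x y : Disc X} (h : dist x y < 1) : x = y := by
  by_contra hne
  simp [Disc.dist_def, hne] at h

/-- The space `½ · X`: all distances are halved. -/
@[ext] structure Half (X : Type u) where
  val : X

noncomputable instance (X : Type u) [MetricSpace X] [UMet X] : MetricSpace (Half X) :=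
  MetricSpace.ofUltra (fun x y => dist x.val y.val / 2) (by simp)
    (fun x y h => Half.ext (dist_eq_zero.1 (by linarith)))
    (fun x y => by rw [dist_comm])
    (fun x y z => by
      have := UMet.ultra x.val y.val z.val
      rcases le_max_iff.1 this with h | h
      · exact le_max_of_le_left (by linarith)
      · exact le_max_of_le_right (by linarith))

theorem Half.dist_def {X : Type u} [MetricSpace X] [UMet X] (x y : Half X) :
    dist x y = dist x.val y.val / 2 := rfl

instance (X : Type u) [MetricSpace X] [UMet X] : UMet (Half X) where
  ultra x y z := by
    simp only [Half.dist_def]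
    rcases le_max_iff.1 (UMet.ultra x.val y.val z.val) with h | h
    · exact le_max_of_le_left (by linarith)
    · exact le_max_of_le_right (by linarith)
  le_one x y := by
    have := UMet.le_one x.val y.val
    rw [Half.dist_def]; linarith

/-- Disjoint union; elements of different summands have distance `1`. -/
inductive MSum (X Y : Type u) : Type u
  | inl (x : X)
  | inr (y : Y)

/-- The distance of a disjoint union. -/
def MSum.d {X Y : Type u} [Dist X] [Dist Y] : MSum X Y → MSum X Y → ℝ
  | .inl x, .inl x' => dist x x'
  | .inr y, .inr y' => dist y y'
  | _, _ => 1

theorem MSum.d_ultra {X Y : Type u} [MetricSpace X] [UMet X] [MetricSpace Y] [UMet Y]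
    (x y z : MSum X Y) : MSum.d x z ≤ max (MSum.d x y) (MSum.d y z) := by
  cases x <;> cases y <;> cases z <;> simp only [MSum.d] <;>
    first
    | exact UMet.ultra _ _ _
    | (simp; done)
    | exact (UMet.le_one _ _).trans (by simp)

noncomputable instance (X Y : Type u) [MetricSpace X] [UMet X] [MetricSpace Y] [UMet Y] :
    MetricSpace (MSum X Y) :=
  MetricSpace.ofUltra MSum.d (fun x => by cases x <;> simp [MSum.d])
    (fun x y h => by cases x <;> cases y <;> simp_all [MSum.d])
    (fun x y => by cases x <;> cases y <;> simp [MSum.d, dist_comm]) MSum.d_ultra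

theorem MSum.dist_def {X Y : Type u} [MetricSpace X] [UMet X] [MetricSpace Y] [UMet Y]
    (x y : MSum X Y) : dist x y = MSum.d x y := rfl

instance (X Y : Type u) [MetricSpace X] [UMet X] [MetricSpace Y] [UMet Y] : UMet (MSum X Y) where
  ultra := MSum.d_ultra
  le_one x y := by
    cases x <;> cases y <;> simp [MSum.dist_def, MSum.d, UMet.le_one]

instance (X Y : Type u) [MetricSpace X] [UMet X] [MetricSpace Y] [UMet Y] : UMet (X × Y) where
  ultra x y z := by
    simp only [Prod.dist_eq]
    have h1 := UMet.ultra x.1 y.1 z.1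
    have h2 := UMet.ultra x.2 y.2 z.2
    refine max_le (h1.trans ?_) (h2.trans ?_)
    · exact max_le_max (le_max_left _ _) (le_max_left _ _)
    · exact max_le_max (le_max_right _ _) (le_max_right _ _)
  le_one x y := by
    rw [Prod.dist_eq]; exact max_le (UMet.le_one _ _) (UMet.le_one _ _)

instance : UMet PUnit.{u + 1} where
  ultra x y z := by simp
  le_one x y := by simp

/-- `A →ᵤ X` is the space of all functions with the supremum distance. -/
instance (A X : Type u) [MetricSpace X] [UMet X] : UMet (A →ᵤ X) where
  ultra f g h := by
    refine (UniformFun.dist_le (le_max_of_le_left dist_nonneg)).2 fun x => ?_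
    refine (UMet.ultra _ (UniformFun.toFun g x) _).trans (max_le_max ?_ ?_)
    · exact (UniformFun.dist_le dist_nonneg).1 le_rfl x
    · exact (UniformFun.dist_le dist_nonneg).1 le_rfl x
  le_one f g := (UniformFun.dist_le zero_le_one).2 fun x => UMet.le_one _ _

/-- The nonexpansive functions `X →¹ Y`. -/
@[ext] structure NE (X Y : Type u) [MetricSpace X] [MetricSpace Y] where
  toFun : X → Y
  ne : ∀ x y, dist (toFun x) (toFun y) ≤ dist x y

instance (X Y : Type u) [MetricSpace X] [MetricSpace Y] : CoeFun (NE X Y) fun _ => X → Y :=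
  ⟨NE.toFun⟩

/-- The metric on `X →¹ Y` is the supremum distance. -/
noncomputable instance (X Y : Type u) [MetricSpace X] [MetricSpace Y] [UMet Y] :
    MetricSpace (NE X Y) :=
  MetricSpace.induced (fun f => UniformFun.ofFun f.toFun)
    (fun _ _ h => NE.ext (UniformFun.ofFun.injective h)) inferInstance

theorem NE.dist_le {X Y : Type u} [MetricSpace X] [MetricSpace Y] [UMet Y] {f g : NE X Y} {r : ℝ}
    (hr : 0 ≤ r) : dist f g ≤ r ↔ ∀ x, dist (f x) (g x) ≤ r :=
  UniformFun.dist_le hr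

theorem NE.dist_apply_le {X Y : Type u} [MetricSpace X] [MetricSpace Y] [UMet Y] (f g : NE X Y)
    (x : X) : dist (f x) (g x) ≤ dist f g :=
  (NE.dist_le dist_nonneg).1 le_rfl x

instance (X Y : Type u) [MetricSpace X] [MetricSpace Y] [UMet Y] : UMet (NE X Y) where
  ultra _ g _ := UMet.ultra (X := X →ᵤ Y) _ (UniformFun.ofFun g.toFun) _
  le_one _ _ := UMet.le_one (X := X →ᵤ Y) _ _

theorem NE.dist_apply₂ {X Y : Type u} [MetricSpace X] [MetricSpace Y] [UMet Y] (f g : NE X Y)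
    (x y : X) : dist (f x) (g y) ≤ max (dist f g) (dist x y) :=
  (UMet.ultra _ (g x) _).trans (max_le_max (NE.dist_apply_le f g x) (g.ne x y))

instance (X Y : Type u) [MetricSpace X] [MetricSpace Y] [UMet Y] [CompleteSpace Y] :
    CompleteSpace (NE X Y) := by
  have hi : Isometry (fun f : NE X Y => UniformFun.ofFun f.toFun) := fun _ _ => rfl
  rw [completeSpace_iff_isComplete_range hi.isUniformInducing]
  refine IsClosed.isComplete ?_
  have : Set.range (fun f : NE X Y => UniformFun.ofFun f.toFun) =
      ⋂ (x : X) (y : X), {f : X →ᵤ Y | dist (UniformFun.toFun f x) (UniformFun.toFun f y)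
        ≤ dist x y} := by
    ext f
    simp only [Set.mem_range, Set.mem_iInter, Set.mem_ofPred_eq]
    exact ⟨fun ⟨g, hg⟩ x y => hg ▸ g.ne x y, fun h => ⟨⟨UniformFun.toFun f, h⟩, rfl⟩⟩
  rw [this]
  refine isClosed_iInter fun x => isClosed_iInter fun y => ?_
  refine isClosed_le (Continuous.dist ?_ ?_) continuous_const
  · exact (UniformFun.lipschitzWith_eval x).continuous
  · exact (UniformFun.lipschitzWith_eval y).continuous

/-- Finite sequences over `X` of length at most `n`, i.e. `∑_{i ≤ n} X^i`. -/
@[ext] structure BList (X : Type u) (n : ℕ) where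
  val : List X
  length_le : val.length ≤ n

/-- The maximum distance for sequences of the same length, and `1` otherwise (for distances
in `[0, 1]`). -/
def listDist {X : Type u} [Dist X] : List X → List X → ℝ
  | [], [] => 0
  | x :: l, y :: m => max (dist x y) (listDist l m)
  | _, _ => 1

section listDist
variable {X : Type u} [MetricSpace X]

theorem listDist_self : ∀ l : List X, listDist l l = 0
  | [] => rfl
  | x :: l => by simp [listDist, listDist_self l]

theorem listDist_le_one [UMet X] : ∀ l m : List X, listDist l m ≤ 1
  | [], [] => by simp [listDist]
  | x :: l, y :: m => by simp [listDist, UMet.le_one, listDist_le_one l m]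
  | [], _ :: _ => by simp [listDist]
  | _ :: _, [] => by simp [listDist]

theorem listDist_comm : ∀ l m : List X, listDist l m = listDist m l
  | [], [] => by simp [listDist]
  | x :: l, y :: m => by simp [listDist, dist_comm, listDist_comm l m]
  | [], _ :: _ => by simp [listDist]
  | _ :: _, [] => by simp [listDist]

theorem listDist_nonneg : ∀ l m : List X, 0 ≤ listDist l m
  | [], [] => by simp [listDist]
  | x :: l, y :: m => by simp [listDist]
  | [], _ :: _ => by simp [listDist]
  | _ :: _, [] => by simp [listDist]

theorem listDist_eq : ∀ l m : List X, listDist l m = 0 → l = m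
  | [], [] => by simp
  | x :: l, y :: m => fun h => by
    simp only [listDist] at h
    have h1 : dist x y ≤ 0 := h ▸ le_max_left _ _
    have h2 : listDist l m ≤ 0 := h ▸ le_max_right _ _
    rw [dist_le_zero.1 h1, listDist_eq l m (le_antisymm h2 (listDist_nonneg l m))]
  | [], _ :: _ => by simp [listDist]
  | _ :: _, [] => by simp [listDist]

theorem listDist_ultra [UMet X] : ∀ l m k : List X, listDist l k ≤ max (listDist l m) (listDist m k)
  | [], m, [] => by
    rw [listDist_self]; exact le_max_of_le_left (listDist_nonneg _ _)
  | x :: l, y :: m, z :: k => by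
    simp only [listDist]
    refine max_le ((UMet.ultra x y z).trans ?_) ((listDist_ultra l m k).trans ?_)
    · exact max_le_max (le_max_left _ _) (le_max_left _ _)
    · exact max_le_max (le_max_right _ _) (le_max_right _ _)
  | x :: l, [], z :: k => (listDist_le_one _ _).trans (by simp [listDist])
  | [], [], z :: k => by simp [listDist]
  | [], y :: m, z :: k => by simp [listDist]
  | x :: l, [], [] => by simp [listDist]
  | x :: l, y :: m, [] => by simp [listDist]

theorem length_eq_of_listDist : ∀ {l m : List X}, listDist l m < 1 → l.length = m.length
  | [], [] => by simp
  | x :: l, y :: m => fun h => by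
    simp only [listDist] at h
    simpa using length_eq_of_listDist ((le_max_right _ _).trans_lt h)
  | [], _ :: _ => by simp [listDist]
  | _ :: _, [] => by simp [listDist]

end listDist

noncomputable instance (X : Type u) (n : ℕ) [MetricSpace X] [UMet X] : MetricSpace (BList X n) :=
  MetricSpace.ofUltra (fun l m => listDist l.val m.val) (fun _ => listDist_self _)
    (fun _ _ h => BList.ext (listDist_eq _ _ h)) (fun _ _ => listDist_comm _ _)
    (fun _ _ _ => listDist_ultra _ _ _)

theorem BList.dist_def {X : Type u} {n : ℕ} [MetricSpace X] [UMet X] (l m : BList X n) :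
    dist l m = listDist l.val m.val := rfl

instance (X : Type u) (n : ℕ) [MetricSpace X] [UMet X] : UMet (BList X n) where
  ultra _ _ _ := listDist_ultra _ _ _
  le_one _ _ := listDist_le_one _ _

theorem NonemptyCompacts.dist_le {X : Type u} [MetricSpace X] {p q : NonemptyCompacts X} {r : ℝ}
    (hr : 0 ≤ r) : dist p q ≤ r ↔
      (∀ x ∈ p, ∃ y ∈ q, dist x y ≤ r) ∧ (∀ y ∈ q, ∃ x ∈ p, dist y x ≤ r) := by
  rw [Metric.NonemptyCompacts.dist_eq]
  have fin := Metric.hausdorffEDist_ne_top_of_nonempty_of_bounded p.nonempty q.nonempty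
    p.isCompact.isBounded q.isCompact.isBounded
  constructor
  · intro h
    constructor
    · intro x hx
      obtain ⟨y, hy, hxy⟩ := q.isCompact.exists_infDist_eq_dist q.nonempty x
      exact ⟨y, hy, hxy ▸ (Metric.infDist_le_hausdorffDist_of_mem hx fin).trans h⟩
    · intro x hx
      obtain ⟨y, hy, hxy⟩ := p.isCompact.exists_infDist_eq_dist p.nonempty x
      rw [Metric.hausdorffDist_comm] at h
      rw [Metric.hausdorffEDist_comm] at fin
      exact ⟨y, hy, hxy ▸ (Metric.infDist_le_hausdorffDist_of_mem hx fin).trans h⟩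
  · rintro ⟨h1, h2⟩
    exact Metric.hausdorffDist_le_of_mem_dist hr h1 h2

/-- The nonempty compact subsets with the Hausdorff distance. -/
instance (X : Type u) [MetricSpace X] [UMet X] : UMet (NonemptyCompacts X) where
  ultra p q s := by
    have h1 := (NonemptyCompacts.dist_le (p := p) (q := q) dist_nonneg).1 le_rfl
    have h2 := (NonemptyCompacts.dist_le (p := q) (q := s) dist_nonneg).1 le_rfl
    refine (NonemptyCompacts.dist_le (le_max_of_le_left dist_nonneg)).2 ⟨fun x hx => ?_,
      fun z hz => ?_⟩
    · obtain ⟨y, hy, hxy⟩ := h1.1 x hx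
      obtain ⟨z, hz, hyz⟩ := h2.1 y hy
      exact ⟨z, hz, (UMet.ultra _ y _).trans (max_le_max hxy hyz)⟩
    · obtain ⟨y, hy, hyz⟩ := h2.2 z hz
      obtain ⟨x, hx, hxy⟩ := h1.2 y hy
      exact ⟨x, hx, (UMet.ultra _ y _).trans ((max_le_max hyz hxy).trans_eq (max_comm _ _))⟩
  le_one p q := by
    refine (NonemptyCompacts.dist_le zero_le_one).2 ⟨fun x _ => ?_, fun y _ => ?_⟩
    · obtain ⟨y, hy⟩ := q.nonempty
      exact ⟨y, hy, UMet.le_one _ _⟩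
    · obtain ⟨x, hx⟩ := p.nonempty
      exact ⟨x, hx, UMet.le_one _ _⟩

/-- A bundled ultrametric space. -/
structure Obj : Type (u + 1) where
  X : Type u
  [metric : MetricSpace X]
  [umet : UMet X]

attribute [instance] Obj.metric Obj.umet

/-! ## The final domain -/

/-- The domain `Q ≅ {ε} + A × ½ · Q` of finite and infinite sequences over `A`: two sequences that
first differ at position `k` have distance `2⁻ᵏ`. -/
def QD (A : Type u) : Type u := Stream'.Seq A

section QD
variable {A : Type u}

/-- The empty sequence. -/
def QD.eps : QD A := Stream'.Seq.nil

/-- Prefixing `b · q`. -/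
def QD.cons (b : A) (q : QD A) : QD A := Stream'.Seq.cons b q

/-- The element at position `i`, if there is one. -/
def QD.get? (q : QD A) (i : ℕ) : Option A := Stream'.Seq.get? q i

noncomputable instance : MetricSpace (QD A) :=
  MetricSpace.ofUltra (fun q q' => (PiNat.dist (E := fun _ => Option A)).dist q.get? q'.get?)
    (fun q => PiNat.dist_self (E := fun _ => Option A) q.get?)
    (fun q q' h => Stream'.Seq.ext fun n =>
      congrFun (PiNat.eq_of_dist_eq_zero (E := fun _ => Option A) q.get? q'.get? h) n)
    (fun q q' => PiNat.dist_comm (E := fun _ => Option A) q.get? q'.get?)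
    (fun q q' q'' => PiNat.dist_triangle_nonarch (E := fun _ => Option A) q.get? q'.get? q''.get?)

instance : UMet (QD A) where
  ultra q q' q'' :=
    PiNat.dist_triangle_nonarch (E := fun _ => Option A) q.get? q'.get? q''.get?
  le_one q q' := PiNat.dist_le_one (E := fun _ => Option A) q.get? q'.get?

theorem QD.dist_le_pow {q q' : QD A} {k : ℕ} :
    dist q q' ≤ (1 / 2) ^ k ↔ ∀ i < k, q.get? i = q'.get? i := by
  have h := PiNat.mem_cylinder_iff_dist_le (E := fun _ => Option A) (x := q'.get?) (y := q.get?)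
    (n := k)
  rw [PiNat.mem_cylinder_iff] at h
  exact h.symm

theorem QD.dist_eq_pow {q q' : QD A} (h : q ≠ q') : ∃ k : ℕ, dist q q' = (1 / 2) ^ k := by
  have : q.get? ≠ q'.get? := fun e => h (Stream'.Seq.ext fun n => congrFun e n)
  exact ⟨_, PiNat.dist_eq_of_ne this⟩

theorem QD.get?_cons_zero (b : A) (q : QD A) : (q.cons b).get? 0 = some b :=
  Stream'.Seq.get?_cons_zero b q

theorem QD.get?_cons_succ (b : A) (q : QD A) (i : ℕ) : (q.cons b).get? (i + 1) = q.get? i :=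
  Stream'.Seq.get?_cons_succ b q i

theorem QD.dist_cons (b : A) (q q' : QD A) : dist (q.cons b) (q'.cons b) ≤ dist q q' / 2 := by
  by_cases h : q = q'
  · simp [h]
  · obtain ⟨k, hk⟩ := QD.dist_eq_pow h
    have h1 := QD.dist_le_pow.1 hk.le
    have : dist (q.cons b) (q'.cons b) ≤ (1 / 2) ^ (k + 1) := by
      refine QD.dist_le_pow.2 fun i hi => ?_
      cases i with
      | zero => rw [QD.get?_cons_zero, QD.get?_cons_zero]
      | succ i => rw [QD.get?_cons_succ, QD.get?_cons_succ]; exact h1 i (by omega)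
    rw [hk]
    rw [pow_succ] at this
    linarith

instance : CompleteSpace (QD A) := by
  refine Metric.complete_of_convergent_controlled_sequences (fun n => (1 / 2) ^ n) (by simp) ?_
  intro v hv
  have key : ∀ i m, i + 1 ≤ m → (v m).get? i = (v (i + 1)).get? i := fun i m hm =>
    QD.dist_le_pow.1 (hv (i + 1) m (i + 1) hm le_rfl).le i (Nat.lt_succ_self i)
  let w : QD A := ⟨fun i => (v (i + 1)).get? i, by
    intro i hi
    have h1 : (v (i + 2)).get? i = none := (key i (i + 2) (by omega)).trans hi
    exact Stream'.Seq.le_stable (v (i + 2)) (Nat.le_succ i) h1⟩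
  refine ⟨w, Metric.tendsto_atTop.2 fun ε hε => ?_⟩
  obtain ⟨k, hk⟩ := exists_pow_lt_of_lt_one hε (by norm_num : (1 / 2 : ℝ) < 1)
  refine ⟨k, fun m hm => lt_of_le_of_lt (QD.dist_le_pow.2 fun i hi => ?_) hk⟩
  exact key i m (by omega)

/-- `b₁ ⋯ b_m · q` with all `b_i = b`. -/
def QD.rep (b : A) (m : ℕ) (q : QD A) : QD A := (QD.cons b)^[m] q

theorem QD.rep_agree (b : A) : ∀ (m : ℕ) (q r : QD A), q ≠ QD.eps →
    dist (QD.rep b m q) r ≤ (1 / 2) ^ (m + 1) → ∃ r' : QD A, r' ≠ QD.eps ∧ r = QD.rep b m r'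
  | 0, q, r, hq, h => by
    refine ⟨r, ?_, rfl⟩
    rintro rfl
    have := QD.dist_le_pow.1 h 0 (by omega)
    exact hq (Stream'.Seq.get?_zero_eq_none.1 this)
  | m + 1, q, r, hq, h => by
    have e : QD.rep b (m + 1) q = QD.cons b (QD.rep b m q) := Function.iterate_succ_apply' _ _ _
    rw [e] at h
    have h1 := QD.dist_le_pow.1 h
    have h0 : Stream'.Seq.get? r 0 = some b := (h1 0 (by omega)).symm.trans (QD.get?_cons_zero _ _)
    have hr : r = QD.cons b (Stream'.Seq.tail r) := by
      refine Stream'.Seq.ext fun i => ?_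
      cases i with
      | zero => exact h0.trans (Stream'.Seq.get?_cons_zero _ _).symm
      | succ i =>
        exact (Stream'.Seq.get?_tail r i).symm.trans (Stream'.Seq.get?_cons_succ _ _ _).symm
    obtain ⟨r', hr', e'⟩ := QD.rep_agree b m q (Stream'.Seq.tail r) hq (by
      refine QD.dist_le_pow.2 fun i hi => ?_
      exact (QD.get?_cons_succ _ _ _).symm.trans ((h1 (i + 1) (by omega)).trans
        (Stream'.Seq.get?_tail r i).symm))
    refine ⟨r', hr', ?_⟩
    have e2 : QD.rep b (m + 1) r' = QD.cons b (QD.rep b m r') := Function.iterate_succ_apply' _ _ _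
    rw [e2, hr]
    exact congrArg _ e'

theorem QD.dist_rep_le (b : A) : ∀ (m : ℕ) (q r : QD A),
    dist (QD.rep b m q) (QD.rep b m r) ≤ (1 / 2) ^ m * dist q r
  | 0, q, r => by simp [QD.rep]
  | m + 1, q, r => by
    have e : ∀ q, QD.rep b (m + 1) q = QD.cons b (QD.rep b m q) :=
      fun q => Function.iterate_succ_apply' _ _ _
    rw [e, e, pow_succ]
    have := QD.dist_cons b (QD.rep b m q) (QD.rep b m r)
    have := QD.dist_rep_le b m q r
    linarith

end QD

/-- The final domain of nonempty compact sets of sequences, with the Hausdorff distance. -/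
abbrev PD (A : Type u) : Type u := NonemptyCompacts (QD A)

section PD
variable {A : Type u}

/-- `b · p = {b · q ∣ q ∈ p}`. -/
noncomputable def PD.pre (b : A) (p : PD A) : PD A :=
  p.map (QD.cons b) (LipschitzWith.continuous (K := 1) (LipschitzWith.of_dist_le_mul fun q q' => by
    have := QD.dist_cons b q q'
    have : 0 ≤ dist q q' := dist_nonneg
    simp; linarith))

/-- `b^m · p`. -/
noncomputable def PD.rep (b : A) (m : ℕ) (p : PD A) : PD A := (PD.pre b)^[m] p

/-- The one-element set `{q}`. -/
noncomputable def PD.sing (q : QD A) : PD A := {q}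

theorem PD.dist_pre (b : A) (p p' : PD A) : dist (p.pre b) (p'.pre b) ≤ dist p p' / 2 := by
  have h := (NonemptyCompacts.dist_le (p := p) (q := p') dist_nonneg).1 le_rfl
  refine (NonemptyCompacts.dist_le (by positivity)).2 ⟨?_, ?_⟩
  · rintro _ ⟨x, hx, rfl⟩
    obtain ⟨y, hy, hxy⟩ := h.1 x hx
    exact ⟨_, ⟨y, hy, rfl⟩, (QD.dist_cons b x y).trans (by linarith)⟩
  · rintro _ ⟨x, hx, rfl⟩
    obtain ⟨y, hy, hxy⟩ := h.2 x hx
    exact ⟨_, ⟨y, hy, rfl⟩, (QD.dist_cons b x y).trans (by linarith)⟩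

theorem PD.dist_rep (b : A) (m : ℕ) (p p' : PD A) : dist (p.rep b m) (p'.rep b m) ≤ dist p p' := by
  induction m generalizing p p' with
  | zero => exact le_rfl
  | succ m ih =>
    refine (ih (p.pre b) (p'.pre b)).trans ((PD.dist_pre b p p').trans ?_)
    have : 0 ≤ dist p p' := dist_nonneg
    linarith

/-- `{q ∈ p₁ ∪ p₂ ∣ q = b^m · q̄, q̄ ≠ ε}`. -/
def PD.sel (b : A) (m : ℕ) (p₁ p₂ : PD A) : Set (QD A) :=
  {q | (q ∈ p₁ ∨ q ∈ p₂) ∧ ∃ q', q' ≠ QD.eps ∧ q = QD.rep b m q'}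

theorem PD.isCompact_sel (b : A) (m : ℕ) (p₁ p₂ : PD A) : IsCompact (PD.sel b m p₁ p₂) := by
  have hc : IsClosed {q : QD A | ∃ q', q' ≠ QD.eps ∧ q = QD.rep b m q'} := by
    rw [← isOpen_compl_iff, Metric.isOpen_iff]
    intro r hr
    refine ⟨(1 / 2) ^ (m + 1), by positivity, fun q hq hq' => hr ?_⟩
    obtain ⟨q', h, rfl⟩ := hq'
    exact QD.rep_agree b m q' r h (Metric.mem_ball.1 hq).le
  have := (p₁.isCompact.union p₂.isCompact).inter_right hc
  exact this

open Classical in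
/-- The operator `p₁ ⊎ p₂ = let p̄ = {q ∈ p₁ ∪ p₂ ∣ q = b^m · q̄, q̄ ≠ ε} in
if p̄ = ∅ then {b^m} else p̄`. -/
noncomputable def PD.union (b : A) (m : ℕ) (p₁ p₂ : PD A) : PD A :=
  if h : (PD.sel b m p₁ p₂).Nonempty then ⟨⟨PD.sel b m p₁ p₂, PD.isCompact_sel b m p₁ p₂⟩, h⟩
  else PD.sing (QD.rep b m QD.eps)

theorem PD.mem_union_rep {b : A} {m : ℕ} {p₁ p₂ : PD A} {q : QD A} (h : q ∈ PD.union b m p₁ p₂) :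
    ∃ q', q = QD.rep b m q' := by
  unfold PD.union at h
  split_ifs at h with hn
  · obtain ⟨-, q', -, e⟩ := h
    exact ⟨q', e⟩
  · exact ⟨QD.eps, h⟩

theorem PD.dist_union_le_pow (b : A) (m : ℕ) (p₁ p₂ p₁' p₂' : PD A) :
    dist (PD.union b m p₁ p₂) (PD.union b m p₁' p₂') ≤ (1 / 2) ^ m := by
  have key : ∀ q r : QD A, dist (QD.rep b m q) (QD.rep b m r) ≤ (1 / 2) ^ m := fun q r =>
    (QD.dist_rep_le b m q r).trans (mul_le_of_le_one_right (by positivity) (UMet.le_one q r))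
  refine (NonemptyCompacts.dist_le (by positivity)).2 ⟨fun x hx => ?_, fun x hx => ?_⟩
  · obtain ⟨x', rfl⟩ := PD.mem_union_rep hx
    obtain ⟨y, hy⟩ := (PD.union b m p₁' p₂').nonempty
    obtain ⟨y', rfl⟩ := PD.mem_union_rep hy
    exact ⟨_, hy, key _ _⟩
  · obtain ⟨x', rfl⟩ := PD.mem_union_rep hx
    obtain ⟨y, hy⟩ := (PD.union b m p₁ p₂).nonempty
    obtain ⟨y', rfl⟩ := PD.mem_union_rep hy
    exact ⟨_, hy, key _ _⟩

theorem PD.sel_close (b : A) (m : ℕ) (p₁ p₂ p₁' p₂' : PD A) {r : ℝ} (hr : 0 ≤ r)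
    (h₁ : dist p₁ p₁' ≤ r) (h₂ : dist p₂ p₂' ≤ r) (hm : r ≤ (1 / 2) ^ (m + 1)) :
    ∀ x ∈ PD.sel b m p₁ p₂, ∃ y ∈ PD.sel b m p₁' p₂', dist x y ≤ r := by
  rintro x ⟨hx, x', hx', rfl⟩
  rcases hx with hx | hx
  · obtain ⟨y, hy, hxy⟩ := ((NonemptyCompacts.dist_le hr).1 h₁).1 _ hx
    obtain ⟨y', hy', rfl⟩ := QD.rep_agree b m x' y hx' (hxy.trans hm)
    exact ⟨_, ⟨Or.inl hy, y', hy', rfl⟩, hxy⟩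
  · obtain ⟨y, hy, hxy⟩ := ((NonemptyCompacts.dist_le hr).1 h₂).1 _ hx
    obtain ⟨y', hy', rfl⟩ := QD.rep_agree b m x' y hx' (hxy.trans hm)
    exact ⟨_, ⟨Or.inr hy, y', hy', rfl⟩, hxy⟩

theorem PD.dist_eq_zero_or_pow (p q : PD A) (m : ℕ) :
    dist p q ≤ (1 / 2) ^ (m + 1) ∨ (1 / 2) ^ m ≤ dist p q := by
  by_contra! h
  refine absurd ((NonemptyCompacts.dist_le (p := p) (q := q) (r := (1 / 2) ^ (m + 1))
    (by positivity)).2 ?_) (not_le.2 h.1)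
  have hd := (NonemptyCompacts.dist_le (p := p) (q := q) dist_nonneg).1 le_rfl
  have key : ∀ x y : QD A, dist x y ≤ dist p q → dist x y ≤ (1 / 2) ^ (m + 1) := by
    intro x y hxy
    by_cases e : x = y
    · simp [e]
    · obtain ⟨k, hk⟩ := QD.dist_eq_pow e
      rw [hk] at hxy ⊢
      have : (1 / 2 : ℝ) ^ k < (1 / 2) ^ m := hxy.trans_lt h.2
      have := (pow_lt_pow_iff_right_of_lt_one₀ (by norm_num) (by norm_num)).1 this
      exact pow_le_pow_of_le_one (by norm_num) (by norm_num) this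
  refine ⟨fun x hx => ?_, fun x hx => ?_⟩
  · obtain ⟨y, hy, hxy⟩ := hd.1 x hx
    exact ⟨y, hy, key _ _ hxy⟩
  · obtain ⟨y, hy, hxy⟩ := hd.2 x hx
    exact ⟨y, hy, key _ _ hxy⟩

theorem PD.dist_union (b : A) (m : ℕ) (p₁ p₂ p₁' p₂' : PD A) :
    dist (PD.union b m p₁ p₂) (PD.union b m p₁' p₂') ≤ max (dist p₁ p₁') (dist p₂ p₂') := by
  rcases PD.dist_eq_zero_or_pow p₁ p₁' m with h₁ | h₁
  swap
  · exact (PD.dist_union_le_pow b m _ _ _ _).trans (le_max_of_le_left h₁)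
  rcases PD.dist_eq_zero_or_pow p₂ p₂' m with h₂ | h₂
  swap
  · exact (PD.dist_union_le_pow b m _ _ _ _).trans (le_max_of_le_right h₂)
  have hr : 0 ≤ max (dist p₁ p₁') (dist p₂ p₂') := le_max_of_le_left dist_nonneg
  have a := PD.sel_close b m p₁ p₂ p₁' p₂' hr (le_max_left _ _) (le_max_right _ _) (max_le h₁ h₂)
  have c := PD.sel_close b m p₁' p₂' p₁ p₂ hr (by rw [dist_comm]; exact le_max_left _ _)
    (by rw [dist_comm]; exact le_max_right _ _) (max_le h₁ h₂)
  by_cases hn : (PD.sel b m p₁ p₂).Nonempty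
  · have hn' : (PD.sel b m p₁' p₂').Nonempty := by
      obtain ⟨x, hx⟩ := hn
      obtain ⟨y, hy, -⟩ := a x hx
      exact ⟨y, hy⟩
    rw [PD.union, PD.union, dif_pos hn, dif_pos hn']
    exact (NonemptyCompacts.dist_le hr).2 ⟨a, c⟩
  · have hn' : ¬ (PD.sel b m p₁' p₂').Nonempty := by
      rintro ⟨x, hx⟩
      obtain ⟨y, hy, -⟩ := c x hx
      exact hn ⟨y, hy⟩
    rw [PD.union, PD.union, dif_neg hn, dif_neg hn', dist_self]
    exact hr

end PD

/-! ## Identifiers -/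

/-- Identifiers `α ::= • ∣ (;•) ∣ (α;) ∣ (α\c) ∣ (α∥) ∣ (∥α)` over a set `N` of names. -/
inductive Ident (N : Type u) : Type u
  | hole
  | seqR
  | seqL (α : Ident N)
  | nu (α : Ident N) (c : N)
  | parL (α : Ident N)
  | parR (α : Ident N)

namespace Ident
variable {N : Type u}

/-- The substitution `α(β)` of the hole of `α`. -/
def subst : Ident N → Ident N → Ident N
  | hole, β => β
  | seqR, _ => seqR
  | seqL α, β => seqL (α.subst β)
  | nu α c, β => nu (α.subst β) c
  | parL α, β => parL (α.subst β)
  | parR α, β => parR (α.subst β)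

/-- The prefix order `α ≤ α'`. -/
def le : Ident N → Ident N → Prop
  | hole, _ => True
  | seqR, seqR => True
  | seqL α, seqL β => α.le β
  | parL α, parL β => α.le β
  | parR α, parR β => α.le β
  | nu α c, nu β d => c = d ∧ α.le β
  | _, _ => False

open Classical in
/-- The greatest lower bound of two identifiers. -/
noncomputable def glb : Ident N → Ident N → Ident N
  | seqR, seqR => seqR
  | seqL α, seqL β => seqL (α.glb β)
  | parL α, parL β => parL (α.glb β)
  | parR α, parR β => parR (α.glb β)
  | nu α c, nu β d => if c = d then nu (α.glb β) c else hole
  | _, _ => hole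

open Classical in
/-- The difference `α ⊖ β`, where `none` stands for `↑`. -/
noncomputable def minus : Ident N → Ident N → Option (Ident N)
  | α, hole => some α
  | seqL α, seqL β => α.minus β
  | parL α, parL β => α.minus β
  | parR α, parR β => α.minus β
  | nu α c, nu β d => if c = d then α.minus β else none
  | _, _ => none

/-- The name `c` occurs restricted in the identifier. -/
def Restricts (c : N) : Ident N → Prop
  | hole => False
  | seqR => False
  | nu α d => d = c ∨ α.Restricts c
  | seqL α => α.Restricts c
  | parL α => α.Restricts c
  | parR α => α.Restricts c

/-- If `α'` continues `α` with a restriction of the name `c`, this is `c`, otherwise it is `none`. -/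
noncomputable def nextName : Ident N → Ident N → Option N
  | hole, nu _ c => some c
  | nu α c, nu β d => open Classical in if c = d then α.nextName β else none
  | seqL α, seqL β => α.nextName β
  | parL α, parL β => α.nextName β
  | parR α, parR β => α.nextName β
  | _, _ => none

/-- The number of nodes. -/
def size : Ident N → ℕ
  | hole => 1
  | seqR => 1
  | seqL α => α.size + 1
  | nu α _ => α.size + 1
  | parL α => α.size + 1
  | parR α => α.size + 1

theorem le_size : ∀ {α β : Ident N}, α.le β → α.size ≤ β.size ∧ (α ≠ β → ∀ γ : Ident N, γ.size ≠ 1 →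
    α.size < (α.subst γ).size)
  | hole, β, _ => by
    refine ⟨by cases β <;> simp [size], fun _ γ hγ => ?_⟩
    have h1 : 1 ≤ γ.size := by cases γ <;> simp [size]
    simp only [size, subst]
    omega
  | seqR, β, h => by cases β <;> simp_all [le, size]
  | seqL α, β, h => by
    cases β <;> simp_all only [le]
    have := le_size h
    simp_all [size, subst]
  | parL α, β, h => by
    cases β <;> simp_all only [le]
    have := le_size h
    simp_all [size, subst]
  | parR α, β, h => by
    cases β <;> simp_all only [le]
    have := le_size h
    simp_all [size, subst]
  | nu α c, β, h => by
    cases β <;> simp_all only [le]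
    have := le_size h.2
    simp_all [size, subst]

end Ident

/-- `ι₂(c₁@α₁, c₂@α₂)`: the two actions are executed by different processes, they use the same
channel, and they are not disabled by restrictions. -/
def iota₂ {N : Type u} (p q : N × Ident N) : Prop :=
  p.2 ≠ q.2 ∧ p.1 = q.1 ∧
    (∀ β, p.2.minus (p.2.glb q.2) = some β → ¬ β.Restricts p.1) ∧
    (∀ β, q.2.minus (p.2.glb q.2) = some β → ¬ β.Restricts q.1)

/-! ## Syntax -/

/-- Joint inputs `j ::= c ∣ j & j`. -/
inductive JointInput (N : Type u) : Type u
  | name (c : N)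
  | and (j₁ j₂ : JointInput N)

/-- The multiset of the names that occur in a joint input. -/
def JointInput.names {N : Type u} : JointInput N → Multiset N
  | name c => {c}
  | and j₁ j₂ => j₁.names + j₂.names

/-- Elementary actions `a ::= b ∣ c̄ ∣ j ∣ deadlock`, where `b` is an internal action, `c̄` is a co-name,
and `j` is a joint input of at most `n` names. -/
inductive Act (N A : Type u) (n : ℕ) : Type u
  | int (b : A)
  | out (c : N)
  | inp (j : {j : JointInput N // j.names.card ≤ n})
  | deadlock

/-- Statements `x ::= a ∣ y ∣ x\c ∣ x;x ∣ x+x ∣ x∥x ∣ x|x ∣ x⌊⌊x ∣ x⌊x`. -/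
inductive Stmt (N A Y : Type u) (n : ℕ) : Type u
  | act (a : Act N A n)
  | var (y : Y)
  | res (x : Stmt N A Y n) (c : N)
  | seq (x₁ x₂ : Stmt N A Y n)
  | choice (x₁ x₂ : Stmt N A Y n)
  | merge (x₁ x₂ : Stmt N A Y n)
  | syn (x₁ x₂ : Stmt N A Y n)
  | lmerge (x₁ x₂ : Stmt N A Y n)
  | lsyn (x₁ x₂ : Stmt N A Y n)

/-- Guarded statements `g ::= a ∣ g\c ∣ g;x ∣ g+g ∣ g∥g ∣ g|g ∣ g⌊⌊x ∣ g⌊g`. -/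
def Stmt.Guarded {N A Y : Type u} {n : ℕ} : Stmt N A Y n → Prop
  | .act _ => True
  | .var _ => False
  | .res g _ => g.Guarded
  | .seq g _ => g.Guarded
  | .choice g₁ g₂ => g₁.Guarded ∧ g₂.Guarded
  | .merge g₁ g₂ => g₁.Guarded ∧ g₂.Guarded
  | .syn g₁ g₂ => g₁.Guarded ∧ g₂.Guarded
  | .lmerge g _ => g.Guarded
  | .lsyn g₁ g₂ => g₁.Guarded ∧ g₂.Guarded

/-- Declarations map procedure variables to guarded statements. -/
abbrev Decl (N A Y : Type u) (n : ℕ) : Type u := Y → {g : Stmt N A Y n // g.Guarded}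

/-- Interaction sets: sets of at most `n + 1` pairs `a@α`. -/
@[ext] structure ISet (N A : Type u) (n : ℕ) : Type u where
  val : Finset (Act N A n × Ident N)
  card_le : val.card ≤ n + 1

open Classical in
/-- `{a@α} ∪ u`. -/
noncomputable def ins {N A : Type u} {n : ℕ} (a : Act N A n) (α : Ident N)
    (u : Finset (Act N A n × Ident N)) : Finset (Act N A n × Ident N) :=
  insert (a, α) u

open Classical in
theorem card_ins_le {N A : Type u} {n : ℕ} (a : Act N A n) (α : Ident N)
    (u : Finset (Act N A n × Ident N)) : (ins a α u).card ≤ u.card + 1 :=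
  Finset.card_insert_le _ _

/-- `u = {c̄₁@α₁, …, c̄ₘ@αₘ, (c₁ & ⋯ & cₘ)@α}` with `ι₂(c₁@α₁, c₁@α), …, ι₂(cₘ@αₘ, cₘ@α)`. -/
def IsSync {N A : Type u} {n : ℕ} (u : Finset (Act N A n × Ident N)) : Prop :=
  ∃ (j : {j : JointInput N // j.names.card ≤ n}) (α : Ident N) (v : Finset (N × Ident N)),
    (∀ x, x ∈ u ↔ x = (Act.inp j, α) ∨ ∃ p ∈ v, x = (Act.out p.1, p.2)) ∧
    v.val.map Prod.fst = j.val.names ∧ ∀ p ∈ v, iota₂ p (p.1, α)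

open Classical in
/-- The interaction function `ι`; `none` stands for `↑`. -/
noncomputable def iota {N A : Type u} {n : ℕ} (τ : A) (u : Finset (Act N A n × Ident N)) :
    Option A :=
  if h : ∃ b α, u = {(Act.int b, α)} then some h.choose
  else if IsSync u then some τ else none

/-- Nonempty sequences of at most `n + 1` identifiers, written as `α:μ`. -/
@[ext] structure Ids (N : Type u) (n : ℕ) : Type u where
  head : Ident N
  tail : List (Ident N)
  length_le : tail.length ≤ n

/-! ## The domain of continuations -/

/-- `Den = {φ_E} + ½ · D`. -/
abbrev Den (D : Type u) : Type u := MSum PUnit.{u + 1} (Half D)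

/-- `K = Π × (Id → Den)`, where `Π` is the set of finite sets of identifiers. -/
abbrev K (N D : Type u) : Type u := Disc (Finset (Ident N)) × (Ident N →ᵤ Den D)

/-- Continuations `(φ, u, ⟨μ | κ⟩)`, where `φ` is a sequence of at most `n` elements of `½ · D`, `u`
is an interaction set, and `μ` is a nonempty sequence of at most `n + 1` identifiers. -/
abbrev Cont (N A : Type u) (n : ℕ) (D : Type u) : Type u :=
  BList (Half D) n × Disc (ISet N A n) × Disc (Ids N n) × K N D

/-- The solutions of the domain equation `D ≅ Cont →¹ P_D`. -/
structure Solution (N A : Type u) (n : ℕ) : Type (u + 1) where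
  D : Type u
  [metric : MetricSpace D]
  [umet : UMet D]
  [complete : CompleteSpace D]
  iso : D ≃ᵢ NE (Cont N A n D) (PD A)

attribute [instance] Solution.metric Solution.umet Solution.complete


/-! ### The domain equation has a solution -/

section existence
variable {N A : Type u} {n : ℕ}

/-- The action of `½ · _` on functions. -/
def Half.map {X Y : Type u} (h : X → Y) (x : Half X) : Half Y := ⟨h x.val⟩

/-- The action of `Den` on functions. -/
def Den.map {X Y : Type u} (h : X → Y) : Den X → Den Y
  | .inl e => .inl e
  | .inr x => .inr (Half.map h x)

/-- The action of `Cont` on functions. -/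
def Cont.map {X Y : Type u} (h : X → Y) (γ : Cont N A n X) : Cont N A n Y :=
  (⟨γ.1.val.map (Half.map h), by simpa using γ.1.length_le⟩, γ.2.1, γ.2.2.1, γ.2.2.2.1,
    UniformFun.ofFun fun α => Den.map h (UniformFun.toFun γ.2.2.2.2 α))

theorem Den.map_id' {X : Type u} {h : X → X} (e : ∀ x, h x = x) (d : Den X) : Den.map h d = d := by
  cases d <;> simp [Den.map, Half.map, e]

theorem Cont.map_id' {X : Type u} {h : X → X} (e : ∀ x, h x = x) (γ : Cont N A n X) :
    Cont.map h γ = γ := by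
  obtain ⟨⟨l, hl⟩, u, μ, π, θ⟩ := γ
  have h1 : l.map (Half.map h) = l := by
    conv_rhs => rw [← List.map_id l]
    exact List.map_congr_left fun x _ => by simp [Half.map, e]
  have h2 : (UniformFun.ofFun fun α => Den.map h (UniformFun.toFun θ α)) = θ :=
    funext fun α => Den.map_id' e _
  simp only [Cont.map, h1, h2]

theorem Cont.map_map {X Y Z : Type u} (g : Y → Z) (h : X → Y) (γ : Cont N A n X) :
    Cont.map g (Cont.map h γ) = Cont.map (g ∘ h) γ := by
  obtain ⟨⟨l, hl⟩, u, μ, π, θ⟩ := γ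
  have h2 : (UniformFun.ofFun fun α => Den.map g (Den.map h (UniformFun.toFun θ α))) =
      (UniformFun.ofFun fun α => Den.map (g ∘ h) (UniformFun.toFun θ α)) :=
    funext fun α => by
      change Den.map g (Den.map h (UniformFun.toFun θ α)) = Den.map (g ∘ h) (UniformFun.toFun θ α)
      cases UniformFun.toFun θ α <;> rfl
  have h1 : (l.map (Half.map h)).map (Half.map g) = l.map (Half.map (g ∘ h)) := by
    rw [List.map_map]; rfl
  simp only [Cont.map, h1]
  simp only [Prod.mk.injEq, true_and]
  exact h2

variable {X Y : Type u} [MetricSpace X] [MetricSpace Y]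

theorem listDist_map {g h : X → Y} {r : ℝ} (hr : 0 ≤ r)
    (H : ∀ x x', dist (g x) (h x') ≤ max r (dist x x')) : ∀ l m : List X,
    listDist (l.map g) (m.map h) ≤ max r (listDist l m)
  | [], [] => by simp [listDist, hr]
  | x :: l, y :: m => by
    simp only [listDist, List.map_cons]
    refine max_le ((H x y).trans ?_) ((listDist_map hr H l m).trans ?_)
    · exact max_le_max le_rfl (le_max_left _ _)
    · exact max_le_max le_rfl (le_max_right _ _)
  | [], _ :: _ => by simp [listDist]
  | _ :: _, [] => by simp [listDist]

variable [UMet X] [UMet Y]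

theorem Cont.dist_map {g h : X → Y} {r : ℝ} (hr : 0 ≤ r)
    (H : ∀ x x', dist (g x) (h x') ≤ max r (dist x x')) (γ γ' : Cont N A n X) :
    dist (Cont.map g γ) (Cont.map h γ') ≤ max (r / 2) (dist γ γ') := by
  have H' : ∀ x x', dist (Half.map g x) (Half.map h x') ≤ max (r / 2) (dist x x') := by
    intro x x'
    have := H x.val x'.val
    rw [Half.dist_def, Half.dist_def]
    simp only [Half.map]
    rcases le_max_iff.1 this with h | h
    · exact le_max_of_le_left (by linarith)
    · exact le_max_of_le_right (by linarith)
  have hr' : 0 ≤ r / 2 := by positivity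
  have H2 : ∀ d d', dist (Den.map g d) (Den.map h d') ≤ max (r / 2) (dist d d') := by
    intro d d'
    cases d <;> cases d' <;> simp only [Den.map, MSum.dist_def, MSum.d]
    · simp [hr']
    · simp
    · simp
    · exact H' _ _
  obtain ⟨l, u, μ, π, θ⟩ := γ
  obtain ⟨l', u', μ', π', θ'⟩ := γ'
  simp only [Cont.map, Prod.dist_eq]
  refine max_le ?_ (max_le ?_ (max_le ?_ (max_le ?_ ?_)))
  · exact (listDist_map hr' H' l.val l'.val).trans (max_le_max le_rfl (le_max_left _ _))
  · exact le_max_of_le_right (le_max_of_le_right (le_max_left _ _))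
  · exact le_max_of_le_right (le_max_of_le_right (le_max_of_le_right (le_max_left _ _)))
  · exact le_max_of_le_right
      (le_max_of_le_right (le_max_of_le_right (le_max_of_le_right (le_max_left _ _))))
  · have h3 : dist (UniformFun.ofFun fun α => Den.map g (UniformFun.toFun θ α))
        (UniformFun.ofFun fun α => Den.map h (UniformFun.toFun θ' α)) ≤ max (r / 2) (dist θ θ') := by
      refine (UniformFun.dist_le (le_max_of_le_left hr')).2 fun α => ?_
      refine (H2 _ _).trans (max_le_max le_rfl ?_)
      exact (UniformFun.dist_le dist_nonneg).1 le_rfl α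
    refine h3.trans (max_le_max le_rfl ?_)
    exact (le_max_right _ _).trans ((le_max_right _ _).trans
      ((le_max_right _ _).trans (le_max_right _ _)))

theorem Cont.dist_map_ne (h : NE X Y) (γ γ' : Cont N A n X) :
    dist (Cont.map h γ) (Cont.map h γ') ≤ dist γ γ' := by
  have := Cont.dist_map (g := h) (h := h) (r := 0) le_rfl
    (fun x x' => le_max_of_le_right (h.ne x x')) γ γ'
  simpa using this

/-- The contravariant action of `Cont(_) →¹ P_D` on nonexpansive functions. -/
def fmap (h : NE X Y) (f : NE (Cont N A n Y) (PD A)) : NE (Cont N A n X) (PD A) where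
  toFun γ := f (Cont.map h γ)
  ne γ γ' := (f.ne _ _).trans (Cont.dist_map_ne h γ γ')

variable (N A n)

/-- The iterates of `Cont(_) →¹ P_D` on the one-point space. -/
noncomputable def tower : ℕ → Obj.{u}
  | 0 => ⟨PUnit⟩
  | k + 1 => ⟨NE (Cont N A n (tower k).X) (PD A)⟩

/-- The transition maps of the tower. -/
noncomputable def tm : ∀ k m : ℕ, NE (tower N A n k).X (tower N A n m).X
  | _, 0 => ⟨fun _ => PUnit.unit, fun _ _ => (dist_self _).le.trans dist_nonneg⟩
  | 0, _ + 1 => ⟨fun _ => ⟨fun _ => PD.sing QD.eps, fun _ _ => by simp⟩,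
    fun _ _ => (dist_self _).le.trans dist_nonneg⟩
  | k + 1, m + 1 =>
    ⟨fun f => fmap (tm m k) f, fun f g => (NE.dist_le dist_nonneg).2 fun _ =>
      NE.dist_apply_le f g _⟩
termination_by k m => k + m

theorem tm_succ (k m : ℕ) (f : (tower N A n (k + 1)).X) :
    tm N A n (k + 1) (m + 1) f = fmap (tm N A n m k) f := by
  rw [tm]

theorem tm_zero_succ (m : ℕ) (x : (tower N A n 0).X) :
    tm N A n 0 (m + 1) x = (⟨fun _ => PD.sing QD.eps, fun _ _ => by simp⟩ :
      NE (Cont N A n (tower N A n m).X) (PD A)) := by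
  rw [tm]

instance : Subsingleton (tower N A n 0).X := inferInstanceAs (Subsingleton PUnit)

theorem tm_self (k : ℕ) (x : (tower N A n k).X) : tm N A n k k x = x := by
  induction k with
  | zero => exact Subsingleton.elim _ _
  | succ k ih =>
    rw [tm_succ]
    refine NE.ext (funext fun γ => ?_)
    exact congrArg (NE.toFun x) (Cont.map_id' ih γ)

theorem tm_comp (k m l : ℕ) (h : min k l ≤ m) (x : (tower N A n k).X) :
    tm N A n m l (tm N A n k m x) = tm N A n k l x := by
  induction m generalizing k l with
  | zero =>
    cases l with
    | zero => exact Subsingleton.elim _ _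
    | succ l =>
      cases k with
      | zero => rw [tm_zero_succ, tm_zero_succ]
      | succ k => omega
  | succ m ih =>
    cases l with
    | zero => exact Subsingleton.elim _ _
    | succ l =>
      cases k with
      | zero =>
        refine (congrArg _ (tm_zero_succ N A n m x)).trans ((tm_succ N A n m l _).trans
          (Eq.trans ?_ (tm_zero_succ N A n l x).symm))
        rfl
      | succ k =>
        rw [tm_succ, tm_succ, tm_succ]
        refine NE.ext (funext fun γ => ?_)
        refine congrArg (NE.toFun x) ?_
        rw [Cont.map_map]
        refine congrArg (fun h => Cont.map h γ) (funext fun y => ?_)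
        exact ih l k (by omega) y

theorem tm_approx (k m : ℕ) (x : (tower N A n k).X) :
    dist (tm N A n m k (tm N A n k m x)) x ≤ (1 / 2) ^ m := by
  induction m generalizing k with
  | zero => simpa using UMet.le_one _ _
  | succ m ih =>
    cases k with
    | zero => rw [Subsingleton.elim (tm N A n (m + 1) 0 (tm N A n 0 (m + 1) x)) x]; simp
    | succ k =>
      rw [tm_succ, tm_succ]
      refine (NE.dist_le (by positivity)).2 fun γ => ?_
      refine (NE.ne x _ _).trans ?_
      have e := Cont.map_map (tm N A n m k) (tm N A n k m) γ
      have h := Cont.dist_map (g := tm N A n m k ∘ tm N A n k m) (h := id) (r := (1 / 2) ^ m)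
        (by positivity) (fun y y' => (UMet.ultra _ y _).trans (max_le_max (ih k y) le_rfl)) γ γ
      rw [Cont.map_id' (h := id) (fun _ => rfl), dist_self, max_eq_left (by positivity)] at h
      rw [pow_succ]
      rw [e]
      exact h.trans_eq (by ring)

/-- The limit of the tower. -/
@[ext] structure Lim : Type u where
  val : ∀ k, (tower N A n k).X
  coh : ∀ k m, k ≤ m → tm N A n m k (val m) = val k

theorem bdd_lim (x y : Lim N A n) : BddAbove (Set.range fun k => dist (x.val k) (y.val k)) :=
  ⟨1, by rintro _ ⟨k, rfl⟩; exact UMet.le_one _ _⟩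

theorem lim_ultra (x y z : Lim N A n) : (⨆ k, dist (x.val k) (z.val k)) ≤
    max (⨆ k, dist (x.val k) (y.val k)) (⨆ k, dist (y.val k) (z.val k)) :=
  ciSup_le fun k => (UMet.ultra _ (y.val k) _).trans (max_le_max
    (le_ciSup (bdd_lim N A n x y) k) (le_ciSup (bdd_lim N A n y z) k))

noncomputable instance : MetricSpace (Lim N A n) :=
  MetricSpace.ofUltra (fun x y => ⨆ k, dist (x.val k) (y.val k)) (fun x => by simp)
    (fun x y h => Lim.ext (funext fun k => dist_le_zero.1
      ((le_ciSup (bdd_lim N A n x y) k).trans_eq h)))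
    (fun x y => by simp_rw [dist_comm]) (lim_ultra N A n)

theorem Lim.dist_le {x y : Lim N A n} {r : ℝ} :
    dist x y ≤ r ↔ ∀ k, dist (x.val k) (y.val k) ≤ r :=
  ⟨fun h k => (le_ciSup (bdd_lim N A n x y) k).trans h, fun h => ciSup_le h⟩

instance : UMet (Lim N A n) where
  ultra := lim_ultra N A n
  le_one _ _ := (Lim.dist_le N A n).2 fun _ => UMet.le_one _ _

/-- The projections from the limit. -/
def lpr (k : ℕ) : NE (Lim N A n) (tower N A n k).X :=
  ⟨fun x => x.val k, fun _ _ => (Lim.dist_le N A n).1 le_rfl k⟩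

/-- The injections into the limit. -/
noncomputable def lin (k : ℕ) : NE (tower N A n k).X (Lim N A n) where
  toFun x := ⟨fun m => tm N A n k m x, fun m m' h => tm_comp N A n k m' m (by omega) x⟩
  ne x y := (Lim.dist_le N A n).2 fun m => (tm N A n k m).ne x y

theorem lin_lpr (k : ℕ) (x : Lim N A n) : dist (lin N A n k (lpr N A n k x)) x ≤ (1 / 2) ^ k := by
  refine (Lim.dist_le N A n).2 fun m => ?_
  change dist (tm N A n k m (x.val k)) (x.val m) ≤ _
  rcases le_total m k with h | h
  · rw [x.coh m k h, dist_self]; positivity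
  · rw [← x.coh k m h]
    exact tm_approx N A n m k _

/-- The comparison map for the limit. -/
noncomputable def lcmp (f : NE (Cont N A n (Lim N A n)) (PD A)) : Lim N A n where
  val
    | 0 => PUnit.unit
    | k + 1 => fmap (lin N A n k) f
  coh
    | 0, _, _ => Subsingleton.elim _ _
    | _ + 1, 0, h => by omega
    | k + 1, m + 1, h => by
      rw [tm_succ]
      refine NE.ext (funext fun γ => ?_)
      refine congrArg (NE.toFun f) ?_
      rw [Cont.map_map]
      refine congrArg (fun h => Cont.map h γ) (funext fun y => Lim.ext (funext fun l => ?_))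
      exact tm_comp N A n k m l (by omega) y

theorem lcmp_isometry : Isometry (lcmp N A n) := by
  refine Isometry.of_dist_eq fun f g => le_antisymm ?_ ?_
  · refine (Lim.dist_le N A n).2 fun k => ?_
    cases k with
    | zero => rw [Subsingleton.elim ((lcmp N A n f).val 0) ((lcmp N A n g).val 0)]; simp
    | succ k => exact (NE.dist_le dist_nonneg).2 fun γ => NE.dist_apply_le f g _
  · refine (NE.dist_le dist_nonneg).2 fun γ => ?_
    refine le_of_forall_pos_le_add fun ε hε => ?_
    obtain ⟨k, hk⟩ := exists_pow_lt_of_lt_one hε (by norm_num : (1 / 2 : ℝ) < 1)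
    have key : dist (Cont.map (lin N A n k) (Cont.map (lpr N A n k) γ)) γ ≤ (1 / 2) ^ k := by
      have h := Cont.dist_map (g := lin N A n k ∘ lpr N A n k) (h := id) (r := (1 / 2) ^ k)
        (by positivity) (fun y y' => (UMet.ultra _ y _).trans
          (max_le_max (lin_lpr N A n k y) le_rfl)) γ γ
      rw [Cont.map_id' (h := id) (fun _ => rfl), dist_self, max_eq_left (by positivity),
        ← Cont.map_map] at h
      have : (0 : ℝ) ≤ (1 / 2) ^ k := by positivity
      linarith
    have h1 := (f.ne _ _).trans key
    have h2 := (g.ne _ _).trans key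
    have h3 : dist (f (Cont.map (lin N A n k) (Cont.map (lpr N A n k) γ)))
        (g (Cont.map (lin N A n k) (Cont.map (lpr N A n k) γ))) ≤
        dist (lcmp N A n f) (lcmp N A n g) := by
      have h4 : dist (fmap (lin N A n k) f) (fmap (lin N A n k) g) ≤
          dist (lcmp N A n f) (lcmp N A n g) :=
        (Lim.dist_le N A n (x := lcmp N A n f) (y := lcmp N A n g)).1 le_rfl (k + 1)
      exact (NE.dist_le dist_nonneg).1 h4 (Cont.map (lpr N A n k) γ)
    have h0 : 0 ≤ dist (lcmp N A n f) (lcmp N A n g) := dist_nonneg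
    refine (UMet.ultra _ (f (Cont.map (lin N A n k) (Cont.map (lpr N A n k) γ))) _).trans
      (max_le ?_ ((UMet.ultra _ (g (Cont.map (lin N A n k) (Cont.map (lpr N A n k) γ))) _).trans
        (max_le ?_ ?_)))
    · rw [dist_comm]; linarith
    · linarith
    · linarith

theorem lcmp_surjective : Function.Surjective (lcmp N A n) := by
  have hc : IsClosed (Set.range (lcmp N A n)) :=
    (lcmp_isometry N A n).isClosedEmbedding.isClosed_range
  intro x
  change x ∈ Set.range (lcmp N A n)
  rw [← hc.closure_eq, Metric.mem_closure_iff]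
  intro ε hε
  obtain ⟨k, hk⟩ := exists_pow_lt_of_lt_one hε (by norm_num : (1 / 2 : ℝ) < 1)
  refine ⟨_, ⟨fmap (lpr N A n k) (x.val (k + 1)), rfl⟩, lt_of_le_of_lt ?_ hk⟩
  have e : lcmp N A n (fmap (lpr N A n k) (x.val (k + 1))) =
      lin N A n (k + 1) (lpr N A n (k + 1) x) := by
    refine Lim.ext (funext fun m => ?_)
    cases m with
    | zero => exact Subsingleton.elim _ _
    | succ m =>
      refine Eq.trans ?_ (tm_succ N A n k m (x.val (k + 1))).symm
      refine NE.ext (funext fun γ => ?_)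
      refine congrArg (NE.toFun (x.val (k + 1))) ?_
      exact Cont.map_map _ _ γ
  rw [e, dist_comm]
  refine (lin_lpr N A n (k + 1) x).trans ?_
  exact pow_le_pow_of_le_one (by norm_num) (by norm_num) (Nat.le_succ k)

/-- The domain equation has a solution. -/
theorem exists_solution : Nonempty (Solution N A n) := by
  have e : NE (Cont N A n (Lim N A n)) (PD A) ≃ᵢ Lim N A n :=
    ⟨Equiv.ofBijective _ ⟨(lcmp_isometry N A n).injective, lcmp_surjective N A n⟩,
      lcmp_isometry N A n⟩
  have : CompleteSpace (Lim N A n) := e.completeSpace_iff.1 inferInstance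
  exact ⟨⟨Lim N A n, e.symm⟩⟩

end existence

/-! ## Semantic operators -/

section continuations
variable {N A : Type u} {n : ℕ} {D : Type u}

open Classical in
/-- `κ[α ↦ d]`. -/
noncomputable def K.upd (κ : K N D) (α : Ident N) (d : Den D) : K N D :=
  (⟨insert α κ.1.val⟩, UniformFun.ofFun (Function.update (UniformFun.toFun κ.2) α d))

/-- The operator `γ, c ↦ γ \ c` on continuations. -/
def Cont.res (γ : Cont N A n D) (c : N) : Cont N A n D :=
  (γ.1, γ.2.1, ⟨⟨γ.2.2.1.val.head.subst (.nu .hole c), γ.2.2.1.val.tail, γ.2.2.1.val.length_le⟩⟩,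
    γ.2.2.2)

/-- The operator `add_;`. -/
noncomputable def Cont.addSeq (φ : D) (γ : Cont N A n D) : Cont N A n D :=
  (γ.1, γ.2.1,
    ⟨⟨γ.2.2.1.val.head.subst (.seqL .hole), γ.2.2.1.val.tail, γ.2.2.1.val.length_le⟩⟩,
    K.upd γ.2.2.2 (γ.2.2.1.val.head.subst .seqR) (.inr ⟨φ⟩))

/-- The operator `add_⌊⌊`. -/
noncomputable def Cont.addLMerge (φ : D) (γ : Cont N A n D) : Cont N A n D :=
  (γ.1, γ.2.1,
    ⟨⟨γ.2.2.1.val.head.subst (.parL .hole), γ.2.2.1.val.tail, γ.2.2.1.val.length_le⟩⟩,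
    K.upd γ.2.2.2 (γ.2.2.1.val.head.subst (.parR .hole)) (.inr ⟨φ⟩))

/-- The number of elements of the interaction set of a continuation. -/
def Cont.cardU (γ : Cont N A n D) : ℕ := γ.2.1.val.val.card

/-- The predicate `len(φ) + |u| < n` on continuations `(φ, u, ⟨μ | κ⟩)`. -/
def Cont.CardG (γ : Cont N A n D) : Prop := γ.1.val.length + γ.cardU < n

/-- The sequence of identifiers of the continuation can be extended by one element. -/
def Cont.HasRoom (γ : Cont N A n D) : Prop := γ.2.2.1.val.tail.length < n

open Classical in
/-- The operator `add_⌊`. The value `(φ:φ', u, ⟨α(•∥):α(∥•):μ | κ⟩)` is used if `len(φ') + |u| < n`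
(this is the only case where the operator is applied) and the sequence of identifiers does not
become too long; elsewhere, where that value need not be a continuation, the operator does
not change the continuation. -/
noncomputable def Cont.addLSyn (φ : D) (γ : Cont N A n D) : Cont N A n D :=
  if h : γ.CardG ∧ γ.HasRoom then
    (⟨⟨φ⟩ :: γ.1.val, by
        have h' : γ.1.val.length + γ.cardU < n := h.1
        rw [List.length_cons]; omega⟩, γ.2.1,
      ⟨⟨γ.2.2.1.val.head.subst (.parL .hole),
        γ.2.2.1.val.head.subst (.parR .hole) :: γ.2.2.1.val.tail, h.2⟩⟩, γ.2.2.2)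
  else γ

/-- The continuation `γ₀ = ((), ∅, ⟨(•) | (∅, λ α. φ_E)⟩)`. -/
def Cont.init : Cont N A n D :=
  (⟨[], by simp⟩, ⟨⟨∅, by simp⟩⟩, ⟨⟨.hole, [], by simp⟩⟩, ⟨∅⟩,
    UniformFun.ofFun fun _ => .inl PUnit.unit)

/-- The identifiers in `π` that extend `α`. -/
def restr (π : Finset (Ident N)) (α : Ident N) : Set (Ident N) := {β | β ∈ π ∧ α.le β}

/-- The names `c` such that an identifier in `π` continues `α` with a restriction of `c`. -/
def restrNames (π : Finset (Ident N)) (α : Ident N) : Set N :=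
  {c | ∃ β ∈ π, α.nextName β = some c}

theorem kd_decr {π : Finset (Ident N)} {α : Ident N} (h₀ : ¬ restr π α = ∅)
    (h₁ : ¬ restr π α = {α}) (γ : Ident N) (hγ : γ.size ≠ 1) :
    π.sup Ident.size + 1 - (α.subst γ).size < π.sup Ident.size + 1 - α.size := by
  have : ∃ β ∈ π, α.le β ∧ α ≠ β := by
    by_contra! h
    obtain ⟨β, hβ⟩ := Set.nonempty_iff_ne_empty.2 h₀
    have e := h β hβ.1 hβ.2
    subst e
    exact h₁ (Set.eq_singleton_iff_unique_mem.2 ⟨hβ, fun β hβ => (h β hβ.1 hβ.2).symm⟩)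
  obtain ⟨β, hβ, hle, hne⟩ := this
  have h1 := (Ident.le_size hle).1
  have h2 := (Ident.le_size hle).2 hne γ hγ
  have h3 : β.size ≤ π.sup Ident.size := Finset.le_sup hβ
  omega

variable [MetricSpace D] [UMet D]

theorem Cont.ext_of_dist_lt {γ γ' : Cont N A n D} (h : dist γ γ' < 1) :
    γ.1.val.length = γ'.1.val.length ∧ γ.2.1 = γ'.2.1 ∧ γ.2.2.1 = γ'.2.2.1 ∧
      γ.2.2.2.1 = γ'.2.2.2.1 := by
  simp only [Prod.dist_eq, max_lt_iff] at h
  exact ⟨length_eq_of_listDist h.1, Disc.eq_of_dist_lt h.2.1, Disc.eq_of_dist_lt h.2.2.1,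
    Disc.eq_of_dist_lt h.2.2.2.1⟩

theorem Cont.dist_parts (γ γ' : Cont N A n D) : dist γ.1 γ'.1 ≤ dist γ γ' ∧
    dist γ.2.2.2 γ'.2.2.2 ≤ dist γ γ' ∧ dist γ.2.2.2.2 γ'.2.2.2.2 ≤ dist γ γ' := by
  simp only [Prod.dist_eq]
  refine ⟨le_max_left _ _, ?_, ?_⟩
  · exact (le_max_right _ _).trans ((le_max_right _ _).trans (le_max_right _ _))
  · exact (le_max_right _ _).trans ((le_max_right _ _).trans ((le_max_right _ _).trans
      (le_max_right _ _)))

open Classical in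
theorem K.dist_upd (κ κ' : K N D) (α : Ident N) (d d' : Den D) (h : κ.1 = κ'.1) :
    dist (K.upd κ α d) (K.upd κ' α d') ≤ max (dist d d') (dist κ κ') := by
  have hr : 0 ≤ max (dist d d') (dist κ κ') := le_max_of_le_left dist_nonneg
  rw [Prod.dist_eq (x := K.upd κ α d)]
  refine max_le ?_ ?_
  · simp [K.upd, h]
  · refine (UniformFun.dist_le hr).2 fun β => ?_
    by_cases e : β = α
    · subst e
      simp [K.upd]
    · have h1 : dist (UniformFun.toFun κ.2 β) (UniformFun.toFun κ'.2 β) ≤ dist κ.2 κ'.2 :=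
        (UniformFun.dist_le dist_nonneg).1 le_rfl β
      have h2 : dist κ.2 κ'.2 ≤ dist κ κ' := le_max_right _ _
      have h3 : dist (Function.update (UniformFun.toFun κ.2) α d β)
          (Function.update (UniformFun.toFun κ'.2) α d' β) ≤ dist κ κ' := by
        rw [Function.update_of_ne e, Function.update_of_ne e]
        exact h1.trans h2
      exact h3.trans (le_max_right _ _)

theorem Cont.dist_res (γ γ' : Cont N A n D) (c : N) : dist (γ.res c) (γ'.res c) ≤ dist γ γ' := by
  rcases lt_or_ge (dist γ γ') 1 with h | h
  swap
  · exact (UMet.le_one _ _).trans h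
  obtain ⟨-, h2, h3, h4⟩ := Cont.ext_of_dist_lt h
  rw [Prod.dist_eq, Prod.dist_eq, Prod.dist_eq]
  simp only [Cont.res, h2, h3, dist_self]
  have := Cont.dist_parts γ γ'
  exact max_le this.1 (max_le dist_nonneg (max_le dist_nonneg this.2.1))

theorem Cont.dist_addSeq (φ φ' : D) (γ γ' : Cont N A n D) :
    dist (Cont.addSeq φ γ) (Cont.addSeq φ' γ') ≤ max (dist φ φ' / 2) (dist γ γ') := by
  rcases lt_or_ge (dist γ γ') 1 with h | h
  swap
  · exact (UMet.le_one _ _).trans (h.trans (le_max_right _ _))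
  obtain ⟨-, h2, h3, h4⟩ := Cont.ext_of_dist_lt h
  rw [Prod.dist_eq, Prod.dist_eq, Prod.dist_eq]
  simp only [Cont.addSeq, h2, h3, dist_self]
  have := Cont.dist_parts γ γ'
  have hr : 0 ≤ max (dist φ φ' / 2) (dist γ γ') := le_max_of_le_right dist_nonneg
  refine max_le (this.1.trans (le_max_right _ _)) (max_le hr (max_le hr ?_))
  exact (K.dist_upd _ _ _ _ _ h4).trans (max_le_max le_rfl this.2.1)

theorem Cont.dist_addLMerge (φ φ' : D) (γ γ' : Cont N A n D) :
    dist (Cont.addLMerge φ γ) (Cont.addLMerge φ' γ') ≤ max (dist φ φ' / 2) (dist γ γ') := by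
  rcases lt_or_ge (dist γ γ') 1 with h | h
  swap
  · exact (UMet.le_one _ _).trans (h.trans (le_max_right _ _))
  obtain ⟨-, h2, h3, h4⟩ := Cont.ext_of_dist_lt h
  rw [Prod.dist_eq, Prod.dist_eq, Prod.dist_eq]
  simp only [Cont.addLMerge, h2, h3, dist_self]
  have := Cont.dist_parts γ γ'
  have hr : 0 ≤ max (dist φ φ' / 2) (dist γ γ') := le_max_of_le_right dist_nonneg
  refine max_le (this.1.trans (le_max_right _ _)) (max_le hr (max_le hr ?_))
  exact (K.dist_upd _ _ _ _ _ h4).trans (max_le_max le_rfl this.2.1)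

theorem Cont.cardG_congr {γ γ' : Cont N A n D} (h : dist γ γ' < 1) :
    (γ.cardU = γ'.cardU ∧ (γ.CardG ↔ γ'.CardG)) ∧ (γ.HasRoom ↔ γ'.HasRoom) := by
  obtain ⟨h1, h2, h3, -⟩ := Cont.ext_of_dist_lt h
  simp only [Cont.CardG, Cont.cardU, Cont.HasRoom, h1, h2, h3, and_self]

theorem Cont.dist_addLSyn (φ φ' : D) (γ γ' : Cont N A n D) :
    dist (Cont.addLSyn φ γ) (Cont.addLSyn φ' γ') ≤ max (dist φ φ' / 2) (dist γ γ') := by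
  rcases lt_or_ge (dist γ γ') 1 with h | h
  swap
  · exact (UMet.le_one _ _).trans (h.trans (le_max_right _ _))
  obtain ⟨-, h2, h3, h4⟩ := Cont.ext_of_dist_lt h
  have hc := Cont.cardG_congr h
  by_cases hs : γ.CardG ∧ γ.HasRoom
  · have hs' : γ'.CardG ∧ γ'.HasRoom := ⟨hc.1.2.1 hs.1, hc.2.1 hs.2⟩
    rw [Cont.addLSyn, Cont.addLSyn, dif_pos hs, dif_pos hs']
    rw [Prod.dist_eq, Prod.dist_eq, Prod.dist_eq]
    simp only [h2, h3, dist_self]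
    have := Cont.dist_parts γ γ'
    have hr : 0 ≤ max (dist φ φ' / 2) (dist γ γ') := le_max_of_le_right dist_nonneg
    refine max_le ?_ (max_le hr (max_le hr (this.2.1.trans (le_max_right _ _))))
    exact max_le_max le_rfl this.1
  · have hs' : ¬ (γ'.CardG ∧ γ'.HasRoom) := fun h' => hs ⟨hc.1.2.2 h'.1, hc.2.2 h'.2⟩
    rw [Cont.addLSyn, Cont.addLSyn, dif_neg hs, dif_neg hs']
    exact le_max_right _ _

end continuations

/-- The operator `⊎ᵢ` on the final domain. -/
noncomputable def PD.nedp {A : Type u} (n : ℕ) (τ : A) (i : ℕ) (p₁ p₂ : PD A) : PD A :=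
  PD.union τ (n - i) p₁ p₂

/-- The set `{τ^{n - i}}`. -/
noncomputable def PD.dead {A : Type u} (n : ℕ) (τ : A) (i : ℕ) : PD A :=
  PD.sing (QD.rep τ (n - i) QD.eps)

namespace Solution
variable {N A : Type u} {n : ℕ} (S : Solution N A n)

/-- The domain of continuations. -/
abbrev C : Type u := Cont N A n S.D

/-- The application `φ(γ)`. -/
noncomputable def app (φ : S.D) (γ : S.C) : PD A := S.iso φ γ

/-- The abstraction `λ γ. f(γ)`. -/
noncomputable def lam (f : S.C → PD A) (h : ∀ γ γ', dist (f γ) (f γ') ≤ dist γ γ') : S.D :=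
  S.iso.symm ⟨f, h⟩

theorem app_lam (f : S.C → PD A) (h : ∀ γ γ', dist (f γ) (f γ') ≤ dist γ γ') (γ : S.C) :
    S.app (S.lam f h) γ = f γ := by
  simp [app, lam]

theorem dist_le {φ φ' : S.D} {r : ℝ} (hr : 0 ≤ r) :
    dist φ φ' ≤ r ↔ ∀ γ, dist (S.app φ γ) (S.app φ' γ) ≤ r := by
  rw [← S.iso.isometry.dist_eq]
  exact NE.dist_le hr

theorem ext {φ φ' : S.D} (h : ∀ γ, S.app φ γ = S.app φ' γ) : φ = φ' :=
  S.iso.injective (NE.ext (funext h))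

theorem dist_app (φ φ' : S.D) (γ γ' : S.C) :
    dist (S.app φ γ) (S.app φ' γ') ≤ max (dist φ φ') (dist γ γ') := by
  rw [← S.iso.isometry.dist_eq φ φ']
  exact NE.dist_apply₂ _ _ _ _

theorem app_ne (φ : S.D) (γ γ' : S.C) : dist (S.app φ γ) (S.app φ γ') ≤ dist γ γ' :=
  (S.iso φ).ne γ γ'

/-- Restriction `φ \ c`. -/
noncomputable def res (φ : S.D) (c : N) : S.D :=
  S.lam (fun γ => S.app φ (γ.res c)) fun _ _ => (S.app_ne φ _ _).trans (Cont.dist_res _ _ c)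

/-- Sequential composition `φ₁ ; φ₂`. -/
noncomputable def seq (φ₁ φ₂ : S.D) : S.D :=
  S.lam (fun γ => S.app φ₁ (Cont.addSeq φ₂ γ)) fun γ γ' => (S.app_ne φ₁ _ _).trans (by
    simpa using Cont.dist_addSeq φ₂ φ₂ γ γ')

/-- Left merge `φ₁ ⌊⌊ φ₂`. -/
noncomputable def lmerge (φ₁ φ₂ : S.D) : S.D :=
  S.lam (fun γ => S.app φ₁ (Cont.addLMerge φ₂ γ)) fun γ γ' => (S.app_ne φ₁ _ _).trans (by
    simpa using Cont.dist_addLMerge φ₂ φ₂ γ γ')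

theorem dist_choice (τ : A) {φ₁ φ₂ φ₁' φ₂' : S.D} (γ γ' : S.C) :
    dist (PD.nedp n τ γ.cardU (S.app φ₁ γ) (S.app φ₂ γ))
      (PD.nedp n τ γ'.cardU (S.app φ₁' γ') (S.app φ₂' γ')) ≤
      max (max (dist φ₁ φ₁') (dist φ₂ φ₂')) (dist γ γ') := by
  rcases lt_or_ge (dist γ γ') 1 with h | h
  swap
  · exact (UMet.le_one _ _).trans (h.trans (le_max_right _ _))
  rw [(Cont.cardG_congr h).1.1]
  refine (PD.dist_union _ _ _ _ _ _).trans (max_le ((S.dist_app _ _ _ _).trans ?_)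
    ((S.dist_app _ _ _ _).trans ?_))
  · exact max_le_max (le_max_left _ _) le_rfl
  · exact max_le_max (le_max_right _ _) le_rfl

/-- Nondeterministic choice `φ₁ ⊕ φ₂`. -/
noncomputable def choice (τ : A) (φ₁ φ₂ : S.D) : S.D :=
  S.lam (fun γ => PD.nedp n τ γ.cardU (S.app φ₁ γ) (S.app φ₂ γ)) fun γ γ' => by
    simpa using S.dist_choice τ (φ₁ := φ₁) (φ₁' := φ₁) (φ₂ := φ₂) (φ₂' := φ₂) γ γ'

open Classical in
/-- The body of the left synchronization merge. -/
noncomputable def lsynApp (τ : A) (φ₁ φ₂ : S.D) (γ : S.C) : PD A :=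
  if γ.CardG then S.app φ₁ (Cont.addLSyn φ₂ γ) else PD.dead n τ γ.cardU

theorem dist_lsynApp (τ : A) (φ₁ φ₂ φ₁' φ₂' : S.D) (γ γ' : S.C) :
    dist (S.lsynApp τ φ₁ φ₂ γ) (S.lsynApp τ φ₁' φ₂' γ') ≤
      max (max (dist φ₁ φ₁') (dist φ₂ φ₂' / 2)) (dist γ γ') := by
  rcases lt_or_ge (dist γ γ') 1 with h | h
  swap
  · exact (UMet.le_one _ _).trans (h.trans (le_max_right _ _))
  have hc := (Cont.cardG_congr h).1
  by_cases hs : γ.CardG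
  · rw [lsynApp, lsynApp, if_pos hs, if_pos (hc.2.1 hs), max_assoc]
    exact (S.dist_app _ _ _ _).trans (max_le_max le_rfl (Cont.dist_addLSyn _ _ _ _))
  · rw [lsynApp, lsynApp, if_neg hs, if_neg (fun h' => hs (hc.2.2 h')), hc.1, dist_self]
    exact le_max_of_le_right dist_nonneg

/-- Left synchronization merge `φ₁ ⌊ φ₂`. -/
noncomputable def lsyn (τ : A) (φ₁ φ₂ : S.D) : S.D :=
  S.lam (S.lsynApp τ φ₁ φ₂) fun γ γ' => by
    simpa using S.dist_lsynApp τ φ₁ φ₂ φ₁ φ₂ γ γ'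

/-- Synchronization merge `φ₁ | φ₂`. -/
noncomputable def syn (τ : A) (φ₁ φ₂ : S.D) : S.D :=
  S.choice τ (S.lsyn τ φ₁ φ₂) (S.lsyn τ φ₂ φ₁)

/-- Parallel composition `φ₁ ∥ φ₂`. -/
noncomputable def merge (τ : A) (φ₁ φ₂ : S.D) : S.D :=
  S.choice τ (S.choice τ (S.lmerge φ₁ φ₂) (S.lmerge φ₂ φ₁)) (S.syn τ φ₁ φ₂)

theorem dist_res (φ φ' : S.D) (c : N) : dist (S.res φ c) (S.res φ' c) ≤ dist φ φ' := by
  refine (S.dist_le dist_nonneg).2 fun γ => ?_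
  rw [res, res, app_lam, app_lam]
  exact (S.dist_le dist_nonneg).1 le_rfl _

theorem dist_seq (φ₁ φ₂ φ₁' φ₂' : S.D) :
    dist (S.seq φ₁ φ₂) (S.seq φ₁' φ₂') ≤ max (dist φ₁ φ₁') (dist φ₂ φ₂' / 2) := by
  refine (S.dist_le (le_max_of_le_left dist_nonneg)).2 fun γ => ?_
  rw [seq, seq, app_lam, app_lam]
  refine (S.dist_app _ _ _ _).trans (max_le_max le_rfl ((Cont.dist_addSeq _ _ γ γ).trans ?_))
  have : 0 ≤ dist φ₂ φ₂' := dist_nonneg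
  rw [dist_self, max_eq_left (by positivity)]

theorem dist_lmerge (φ₁ φ₂ φ₁' φ₂' : S.D) :
    dist (S.lmerge φ₁ φ₂) (S.lmerge φ₁' φ₂') ≤ max (dist φ₁ φ₁') (dist φ₂ φ₂' / 2) := by
  refine (S.dist_le (le_max_of_le_left dist_nonneg)).2 fun γ => ?_
  rw [lmerge, lmerge, app_lam, app_lam]
  refine (S.dist_app _ _ _ _).trans (max_le_max le_rfl ((Cont.dist_addLMerge _ _ γ γ).trans ?_))
  have : 0 ≤ dist φ₂ φ₂' := dist_nonneg
  rw [dist_self, max_eq_left (by positivity)]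

theorem dist_lsyn (τ : A) (φ₁ φ₂ φ₁' φ₂' : S.D) :
    dist (S.lsyn τ φ₁ φ₂) (S.lsyn τ φ₁' φ₂') ≤ max (dist φ₁ φ₁') (dist φ₂ φ₂' / 2) := by
  have hr : 0 ≤ max (dist φ₁ φ₁') (dist φ₂ φ₂' / 2) := le_max_of_le_left dist_nonneg
  refine (S.dist_le hr).2 fun γ => ?_
  rw [lsyn, lsyn, app_lam, app_lam]
  refine (S.dist_lsynApp τ _ _ _ _ γ γ).trans ?_
  rw [dist_self, max_eq_left hr]

theorem dist_choice_le (τ : A) (φ₁ φ₂ φ₁' φ₂' : S.D) :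
    dist (S.choice τ φ₁ φ₂) (S.choice τ φ₁' φ₂') ≤ max (dist φ₁ φ₁') (dist φ₂ φ₂') := by
  have hr : 0 ≤ max (dist φ₁ φ₁') (dist φ₂ φ₂') := le_max_of_le_left dist_nonneg
  refine (S.dist_le hr).2 fun γ => ?_
  rw [choice, choice, app_lam, app_lam]
  refine (S.dist_choice τ γ γ).trans ?_
  rw [dist_self, max_eq_left hr]

theorem dist_merge_le (τ : A) {φ₁ φ₂ φ₁' φ₂' : S.D} {r : ℝ} (h₁ : dist φ₁ φ₁' ≤ r)
    (h₂ : dist φ₂ φ₂' ≤ r) : dist (S.merge τ φ₁ φ₂) (S.merge τ φ₁' φ₂') ≤ r := by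
  have p1 : 0 ≤ dist φ₁ φ₁' := dist_nonneg
  have p2 : 0 ≤ dist φ₂ φ₂' := dist_nonneg
  have a := (S.dist_lmerge φ₁ φ₂ φ₁' φ₂').trans (max_le h₁ (show _ ≤ r by linarith))
  have b := (S.dist_lmerge φ₂ φ₁ φ₂' φ₁').trans (max_le h₂ (show _ ≤ r by linarith))
  have c := (S.dist_lsyn τ φ₁ φ₂ φ₁' φ₂').trans (max_le h₁ (show _ ≤ r by linarith))
  have d := (S.dist_lsyn τ φ₂ φ₁ φ₂' φ₁').trans (max_le h₂ (show _ ≤ r by linarith))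
  exact (S.dist_choice_le τ _ _ _ _).trans (max_le
    ((S.dist_choice_le τ _ _ _ _).trans (max_le a b))
    ((S.dist_choice_le τ _ _ _ _).trans (max_le c d)))

/-- Restriction on `Den`. -/
noncomputable def denRes : Den S.D → N → Den S.D
  | .inl e, _ => .inl e
  | .inr φ, c => .inr ⟨S.res φ.val c⟩

/-- Sequential composition on `Den`. -/
noncomputable def denSeq : Den S.D → Den S.D → Den S.D
  | .inl _, d => d
  | .inr φ, .inl _ => .inr φ
  | .inr φ₁, .inr φ₂ => .inr ⟨S.seq φ₁.val φ₂.val⟩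

/-- Parallel composition on `Den`. -/
noncomputable def denMerge (τ : A) : Den S.D → Den S.D → Den S.D
  | .inl _, d => d
  | .inr φ, .inl _ => .inr φ
  | .inr φ₁, .inr φ₂ => .inr ⟨S.merge τ φ₁.val φ₂.val⟩

theorem dist_denRes {d d' : Den S.D} {r : ℝ} (h : dist d d' ≤ r) (c : N) :
    dist (S.denRes d c) (S.denRes d' c) ≤ r := by
  cases d <;> cases d' <;> simp only [denRes]
  · exact h
  · exact h
  · exact h
  · rename_i φ φ'
    have : dist φ.val φ'.val / 2 ≤ r := h
    have := S.dist_res φ.val φ'.val c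
    change dist (S.res φ.val c) (S.res φ'.val c) / 2 ≤ r
    linarith

theorem dist_denSeq {d e d' e' : Den S.D} {r : ℝ} (h : dist d d' ≤ r) (h' : dist e e' ≤ r) :
    dist (S.denSeq d e) (S.denSeq d' e') ≤ r := by
  cases d <;> cases d' <;> cases e <;> cases e' <;>
    first
    | exact h
    | exact h'
    | exact (UMet.le_one _ _).trans h
    | exact (UMet.le_one _ _).trans h'
    | skip
  rename_i φ₁ φ₁' φ₂ φ₂'
  have h1 : dist φ₁.val φ₁'.val / 2 ≤ r := h
  have h2 : dist φ₂.val φ₂'.val / 2 ≤ r := h'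
  have p2 : 0 ≤ dist φ₂.val φ₂'.val := dist_nonneg
  have := (S.dist_seq φ₁.val φ₂.val φ₁'.val φ₂'.val).trans
    (max_le (show _ ≤ 2 * r by linarith) (show _ ≤ 2 * r by linarith))
  change dist (S.seq φ₁.val φ₂.val) (S.seq φ₁'.val φ₂'.val) / 2 ≤ r
  linarith

theorem dist_denMerge (τ : A) {d e d' e' : Den S.D} {r : ℝ} (h : dist d d' ≤ r)
    (h' : dist e e' ≤ r) : dist (S.denMerge τ d e) (S.denMerge τ d' e') ≤ r := by
  cases d <;> cases d' <;> cases e <;> cases e' <;>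
    first
    | exact h
    | exact h'
    | exact (UMet.le_one _ _).trans h
    | exact (UMet.le_one _ _).trans h'
    | skip
  rename_i φ₁ φ₁' φ₂ φ₂'
  have h1 : dist φ₁.val φ₁'.val / 2 ≤ r := h
  have h2 : dist φ₂.val φ₂'.val / 2 ≤ r := h'
  have := S.dist_merge_le τ (show dist φ₁.val φ₁'.val ≤ 2 * r by linarith)
    (show dist φ₂.val φ₂'.val ≤ 2 * r by linarith)
  change dist (S.merge τ φ₁.val φ₂.val) (S.merge τ φ₁'.val φ₂'.val) / 2 ≤ r
  linarith

open Classical in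
/-- The denotation that is obtained from the part of the bag `(π, θ)` below the identifier `α`. -/
noncomputable def kd (τ : A) (π : Finset (Ident N)) (θ : Ident N → Den S.D) (α : Ident N) :
    Den S.D :=
  if h₀ : restr π α = ∅ then .inl PUnit.unit
  else if h₁ : restr π α = {α} then θ α
  else if h₂ : ∃ c, restrNames π α = {c} then
    S.denRes (kd τ π θ (α.subst (.nu .hole h₂.choose))) h₂.choose
  else if α.subst .seqR ∈ π then
    S.denSeq (kd τ π θ (α.subst (.seqL .hole))) (θ (α.subst .seqR))
  else
    S.denMerge τ (kd τ π θ (α.subst (.parL .hole))) (kd τ π θ (α.subst (.parR .hole)))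
termination_by π.sup Ident.size + 1 - α.size
decreasing_by all_goals exact kd_decr h₀ h₁ _ (by simp [Ident.size])

theorem dist_kd (τ : A) (π : Finset (Ident N)) (θ θ' : Ident N → Den S.D) (α : Ident N) {r : ℝ}
    (hr : 0 ≤ r) (h : ∀ α, dist (θ α) (θ' α) ≤ r) :
    dist (S.kd τ π θ α) (S.kd τ π θ' α) ≤ r := by
  induction hk : π.sup Ident.size + 1 - α.size using Nat.strong_induction_on generalizing α with
  | _ k ih =>
    subst hk
    rw [kd.eq_def S τ π θ α, kd.eq_def S τ π θ' α]
    split_ifs with h₀ h₁ h₂ h₃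
    · simpa using hr
    · exact h α
    · exact S.dist_denRes (ih _ (kd_decr h₀ h₁ _ (by simp [Ident.size])) _ rfl) _
    · exact S.dist_denSeq (ih _ (kd_decr h₀ h₁ _ (by simp [Ident.size])) _ rfl) (h _)
    · exact S.dist_denMerge τ (ih _ (kd_decr h₀ h₁ _ (by simp [Ident.size])) _ rfl)
        (ih _ (kd_decr h₀ h₁ _ (by simp [Ident.size])) _ rfl)

/-- The effect of a successful interaction `b` that is followed by `d`; `none` is a failure. -/
noncomputable def react (τ : A) (i : ℕ) : Option A → Den S.D → PD A
  | some b, .inl _ => PD.sing (QD.rep τ (n - i) (QD.cons b QD.eps))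
  | some b, .inr φ => PD.rep τ (n - i) (PD.pre b (S.app φ.val Cont.init))
  | none, _ => PD.dead n τ i

/-- The meaning of an elementary action. The last clause is for continuations whose sequence of
identifiers does not fit the synchronous continuation. -/
noncomputable def opA (τ : A) (a : Act N A n) : S.C → PD A
  | (⟨[], _⟩, ⟨u⟩, ⟨⟨α, [], _⟩⟩, ⟨π⟩, θ) =>
    if u.val.card ≤ n then
      S.react τ u.val.card (iota τ (ins a α u.val)) (S.kd τ π (UniformFun.toFun θ) .hole)
    else PD.dead n τ u.val.card
  | (⟨φ :: l, hl⟩, ⟨u⟩, ⟨⟨α, β :: μ, hμ⟩⟩, κ) =>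
    if h : u.val.card ≤ n then
      PD.pre τ (S.app φ.val
        (⟨l, by rw [List.length_cons] at hl; omega⟩,
          ⟨⟨ins a α u.val, (card_ins_le a α u.val).trans (by omega)⟩⟩,
          ⟨⟨β, μ, by rw [List.length_cons] at hμ; omega⟩⟩, κ))
    else PD.dead n τ u.val.card
  | (_, ⟨u⟩, _) => PD.dead n τ u.val.card

theorem dist_react (τ : A) (i : ℕ) (o : Option A) (d d' : Den S.D) :
    dist (S.react τ i o d) (S.react τ i o d') ≤ dist d d' := by
  cases o with
  | none => simp [react]
  | some b =>
    cases d <;> cases d'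
    · simp [react]
    · exact UMet.le_one _ _
    · exact UMet.le_one _ _
    · rename_i φ φ'
      simp only [react]
      refine (PD.dist_rep _ _ _ _).trans ((PD.dist_pre _ _ _).trans ?_)
      have : dist (S.app φ.val Cont.init) (S.app φ'.val Cont.init) ≤ dist φ.val φ'.val :=
        (S.dist_le dist_nonneg).1 le_rfl _
      change _ ≤ dist φ.val φ'.val / 2
      linarith

theorem dist_opA (τ : A) (a : Act N A n) (γ γ' : S.C) :
    dist (S.opA τ a γ) (S.opA τ a γ') ≤ dist γ γ' := by
  rcases lt_or_ge (dist γ γ') 1 with h | h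
  swap
  · exact (UMet.le_one _ _).trans h
  obtain ⟨h1, h2, h3, h4⟩ := Cont.ext_of_dist_lt h
  have hp := Cont.dist_parts γ γ'
  obtain ⟨⟨l, hl⟩, ⟨u⟩, ⟨α, μ, hμ⟩, ⟨π⟩, θ⟩ := γ
  obtain ⟨⟨l', hl'⟩, ⟨u'⟩, ⟨α', μ', hμ'⟩, ⟨π'⟩, θ'⟩ := γ'
  simp only [Disc.mk.injEq, Ids.mk.injEq] at h1 h2 h3 h4 
  obtain ⟨rfl, rfl⟩ := h3
  subst h2 h4
  match l, l', μ with
  | [], [], [] =>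
    simp only [opA]
    split_ifs with hu
    · refine (S.dist_react _ _ _ _ _).trans (S.dist_kd τ π _ _ _ dist_nonneg fun β => ?_)
      exact ((UniformFun.dist_le dist_nonneg).1 le_rfl β).trans hp.2.2
    · simp
  | [], [], _ :: _ => simp [opA]
  | [], _ :: _, _ => simp at h1
  | _ :: _, [], _ => simp at h1
  | φ :: l, φ' :: l', [] => simp [opA]
  | φ :: l, φ' :: l', β :: μ =>
    simp only [opA]
    split_ifs with hu
    · refine (PD.dist_pre _ _ _).trans ?_
      have h5 := hp.1
      simp only [BList.dist_def, listDist] at h5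
      have h6 : dist φ.val φ'.val / 2 ≤ _ := (le_max_left _ _).trans h5
      have h7 : listDist l l' ≤ _ := (le_max_right _ _).trans h5
      have h8 := hp.2.1
      generalize dist (α := S.C) _ _ = r at h6 h7 h8 h ⊢
      have hr : 0 ≤ r := (listDist_nonneg l l').trans h7
      refine (div_le_div_of_nonneg_right ((S.dist_app _ _ _ _).trans (max_le
        (show _ ≤ 2 * r by linarith) (show _ ≤ 2 * r from ?_))) (by norm_num)).trans
        (show 2 * r / 2 ≤ r by linarith)
      refine le_trans (b := r) ?_ (by linarith)
      rw [Prod.dist_eq, Prod.dist_eq, Prod.dist_eq]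
      simp only [dist_self]
      exact max_le h7 (max_le hr (max_le hr h8))
    · simp

end Solution

/-! ## Denotational semantics -/

namespace Solution
variable {N A Y : Type u} {n : ℕ} (S : Solution N A n)

open Classical in
/-- The higher-order mapping `Ψ`. -/
noncomputable def Psi (τ : A) (decl : Decl N A Y n) (F : Stmt N A Y n → S.D) :
    Stmt N A Y n → S.D
  | .act a => S.lam (S.opA τ a) (S.dist_opA τ a)
  | .var y => Psi τ decl F (decl y).val
  | .res x c => S.res (Psi τ decl F x) c
  | .seq x₁ x₂ => S.seq (Psi τ decl F x₁) (F x₂)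
  | .choice x₁ x₂ => S.choice τ (Psi τ decl F x₁) (Psi τ decl F x₂)
  | .merge x₁ x₂ =>
    S.choice τ (S.choice τ (S.choice τ
      (S.lmerge (Psi τ decl F x₁) (F x₂))
      (S.lmerge (Psi τ decl F x₂) (F x₁)))
      (S.lsyn τ (Psi τ decl F x₁) (Psi τ decl F x₂)))
      (S.lsyn τ (Psi τ decl F x₂) (Psi τ decl F x₁))
  | .syn x₁ x₂ =>
    S.choice τ (S.lsyn τ (Psi τ decl F x₁) (Psi τ decl F x₂))
      (S.lsyn τ (Psi τ decl F x₂) (Psi τ decl F x₁))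
  | .lmerge x₁ x₂ => S.lmerge (Psi τ decl F x₁) (F x₂)
  | .lsyn x₁ x₂ => S.lsyn τ (Psi τ decl F x₁) (Psi τ decl F x₂)
termination_by x => (if x.Guarded then 0 else 1, sizeOf x)
decreasing_by
  · have h := (decl y).2
    rw [Prod.lex_def]
    left
    simp [h, Stmt.Guarded]
  all_goals
    simp only [Stmt.Guarded]
    rw [Prod.lex_def]
    split_ifs <;> simp_all <;> omega

theorem dist_Psi (τ : A) (decl : Decl N A Y n) {F G : Stmt N A Y n → S.D} {r : ℝ} (hr : 0 ≤ r)
    (h : ∀ x, dist (F x) (G x) ≤ r) (x : Stmt N A Y n) :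
    dist (S.Psi τ decl F x) (S.Psi τ decl G x) ≤ r / 2 := by
  have hF : ∀ x, dist (F x) (G x) / 2 ≤ r / 2 := fun x => by linarith [h x]
  have half : ∀ {d : ℝ}, 0 ≤ d → d ≤ r / 2 → d / 2 ≤ r / 2 := fun h0 h1 => by linarith
  induction x using Psi.induct (decl := decl) with
  | case1 a => rw [Psi, Psi, dist_self]; positivity
  | case2 y ih => rw [Psi, Psi]; exact ih
  | case3 x c ih => rw [Psi, Psi]; exact (S.dist_res _ _ c).trans ih
  | case4 x₁ x₂ ih => rw [Psi, Psi]; exact (S.dist_seq _ _ _ _).trans (max_le ih (hF x₂))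
  | case5 x₁ x₂ ih₁ ih₂ =>
    rw [Psi, Psi]; exact (S.dist_choice_le τ _ _ _ _).trans (max_le ih₁ ih₂)
  | case6 x₁ x₂ ih₁ ih₂ =>
    rw [Psi, Psi]
    refine (S.dist_choice_le τ _ _ _ _).trans (max_le ((S.dist_choice_le τ _ _ _ _).trans (max_le
      ((S.dist_choice_le τ _ _ _ _).trans (max_le ?_ ?_)) ?_)) ?_)
    · exact (S.dist_lmerge _ _ _ _).trans (max_le ih₁ (hF x₂))
    · exact (S.dist_lmerge _ _ _ _).trans (max_le ih₂ (hF x₁))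
    · exact (S.dist_lsyn τ _ _ _ _).trans (max_le ih₁ (half dist_nonneg ih₂))
    · exact (S.dist_lsyn τ _ _ _ _).trans (max_le ih₂ (half dist_nonneg ih₁))
  | case7 x₁ x₂ ih₁ ih₂ =>
    rw [Psi, Psi]
    refine (S.dist_choice_le τ _ _ _ _).trans (max_le ?_ ?_)
    · exact (S.dist_lsyn τ _ _ _ _).trans (max_le ih₁ (half dist_nonneg ih₂))
    · exact (S.dist_lsyn τ _ _ _ _).trans (max_le ih₂ (half dist_nonneg ih₁))
  | case8 x₁ x₂ ih => rw [Psi, Psi]; exact (S.dist_lmerge _ _ _ _).trans (max_le ih (hF x₂))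
  | case9 x₁ x₂ ih₁ ih₂ =>
    rw [Psi, Psi]; exact (S.dist_lsyn τ _ _ _ _).trans (max_le ih₁ (half dist_nonneg ih₂))

theorem existsUnique_fixedPoint (τ : A) (decl : Decl N A Y n) :
    ∃! F : Stmt N A Y n → S.D, S.Psi τ decl F = F := by
  let f : (Stmt N A Y n →ᵤ S.D) → (Stmt N A Y n →ᵤ S.D) := fun F =>
    UniformFun.ofFun (S.Psi τ decl (UniformFun.toFun F))
  have hf : ContractingWith (1 / 2) f := by
    refine ⟨by rw [← NNReal.coe_lt_coe]; norm_num, LipschitzWith.of_dist_le_mul fun F G => ?_⟩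
    refine (UniformFun.dist_le (by positivity)).2 fun x => ?_
    refine (S.dist_Psi τ decl dist_nonneg (fun x => (UniformFun.dist_le dist_nonneg).1 le_rfl x)
      x).trans_eq ?_
    simp; ring
  have : Nonempty (Stmt N A Y n →ᵤ S.D) :=
    ⟨UniformFun.ofFun fun _ => S.lam (fun _ => PD.sing QD.eps) (fun _ _ => by simp)⟩
  exact ⟨UniformFun.toFun hf.fixedPoint, hf.fixedPoint_isFixedPt, fun G hG =>
    hf.fixedPoint_unique (x := UniformFun.ofFun G) hG⟩

/-- The denotational semantics `𝒟 = fix(Ψ)`. -/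
noncomputable def den (τ : A) (decl : Decl N A Y n) : Stmt N A Y n → S.D :=
  (S.existsUnique_fixedPoint τ decl).choose

theorem Psi_den (τ : A) (decl : Decl N A Y n) : S.Psi τ decl (S.den τ decl) = S.den τ decl :=
  (S.existsUnique_fixedPoint τ decl).choose_spec.1

end Solution

/-! ## Resumptions -/

/-- `KRes = Π × (Id → R)`, where `R ::= E ∣ x`; the symbol `E` is `none`. -/
abbrev KRes (N A Y : Type u) (n : ℕ) : Type u :=
  Finset (Ident N) × (Ident N → Option (Stmt N A Y n))

open Classical in
/-- `k[α ↦ x]`. -/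
noncomputable def KRes.upd {N A Y : Type u} {n : ℕ} (k : KRes N A Y n) (α : Ident N)
    (x : Stmt N A Y n) : KRes N A Y n :=
  (insert α k.1, Function.update k.2 α (some x))

/-- The class `Res` of resumptions `(f, u, ⟨μ | k⟩)`, a subset of `SRes × U × ARes`, where `SRes` is
the set of sequences of at most `n` statements and `ARes` is the set of pairs `⟨μ | k⟩`. -/
inductive Res {N A Y : Type u} {n : ℕ} :
    BList (Stmt N A Y n) n → ISet N A n → Ids N n → KRes N A Y n → Prop
  | init (f : BList (Stmt N A Y n) n) (u : ISet N A n) (μ : Ids N n) :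
      f.val = [] → u.val = ∅ → μ.head = .hole → μ.tail = [] → Res f u μ (∅, fun _ => none)
  | act (x : Stmt N A Y n) (a : Act N A n) (f f' : BList (Stmt N A Y n) n) (u u' : ISet N A n)
      (μ μ' : Ids N n) (k : KRes N A Y n) :
      Res f u μ k → f.val = x :: f'.val → u.val.card ≤ n → u'.val = ins a μ.head u.val →
      μ.tail = μ'.head :: μ'.tail → Res f' u' μ' k
  | res (c : N) (f : BList (Stmt N A Y n) n) (u : ISet N A n) (μ μ' : Ids N n)
      (k : KRes N A Y n) :
      Res f u μ k → μ'.head = μ.head.subst (.nu .hole c) → μ'.tail = μ.tail → Res f u μ' k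
  | seq (x : Stmt N A Y n) (f : BList (Stmt N A Y n) n) (u : ISet N A n) (μ μ' : Ids N n)
      (k : KRes N A Y n) :
      Res f u μ k → μ'.head = μ.head.subst (.seqL .hole) → μ'.tail = μ.tail →
      Res f u μ' (k.upd (μ.head.subst .seqR) x)
  | par (x : Stmt N A Y n) (f : BList (Stmt N A Y n) n) (u : ISet N A n) (μ μ' : Ids N n)
      (k : KRes N A Y n) :
      Res f u μ k → μ'.head = μ.head.subst (.parL .hole) → μ'.tail = μ.tail →
      Res f u μ' (k.upd (μ.head.subst (.parR .hole)) x)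
  | syn (x : Stmt N A Y n) (f f' : BList (Stmt N A Y n) n) (u : ISet N A n) (μ μ' : Ids N n)
      (k : KRes N A Y n) :
      Res f u μ k → f.val.length + u.val.card < n → f'.val = x :: f.val →
      μ'.head = μ.head.subst (.parL .hole) →
      μ'.tail = μ.head.subst (.parR .hole) :: μ.tail → Res f' u μ' k

namespace Solution
variable {N A Y : Type u} {n : ℕ} (S : Solution N A n)

/-- The meaning of an element of `R = {E} ∪ Stmt` as an element of `Den`. -/
noncomputable def semR (τ : A) (decl : Decl N A Y n) : Option (Stmt N A Y n) → Den S.D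
  | none => .inl PUnit.unit
  | some x => .inr ⟨S.den τ decl x⟩

/-- The meaning of a resumption as a continuation. -/
noncomputable def sem (τ : A) (decl : Decl N A Y n) (f : BList (Stmt N A Y n) n) (u : ISet N A n)
    (μ : Ids N n) (k : KRes N A Y n) : S.C :=
  (⟨f.val.map fun x => ⟨S.den τ decl x⟩, by simpa using f.length_le⟩, ⟨u⟩, ⟨μ⟩, ⟨k.1⟩,
    UniformFun.ofFun fun α => S.semR τ decl (k.2 α))

/-- `D^𝒟 = {𝒟(x) ∣ x ∈ Stmt}`. -/
def denSet (τ : A) (decl : Decl N A Y n) : Set S.D := Set.range (S.den τ decl)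

/-- `Cont^𝒟`, the set of the meanings of the resumptions. -/
def contSet (τ : A) (decl : Decl N A Y n) : Set S.C :=
  {γ | ∃ f u μ k, Res f u μ k ∧ γ = S.sem τ decl f u μ k}

end Solution

/-! ## Classes of denotable continuations -/

/-- A complete ultrametric space. -/
structure MDom : Type (u + 1) where
  X : Type u
  [metric : MetricSpace X]
  [umet : UMet X]
  [complete : CompleteSpace X]

attribute [instance] MDom.metric MDom.umet MDom.complete

/-- A set as a discrete metric domain. -/
noncomputable def MDom.disc (X : Type u) : MDom.{u} := ⟨Disc X⟩

/-- Argument types. In addition to fixed metric domains `M`, the domains `D` and `C`, products,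
sums, function spaces `B → t`, and the compact and nonempty compact powerdomains,
there are the scaled copies `½ · t`, which occur in the domain equations. -/
inductive ATy : Type (u + 1)
  | M (X : MDom.{u})
  | D
  | C
  | prod (s t : ATy)
  | sum (s t : ATy)
  | fn (B : Type u) (t : ATy)
  | pco (t : ATy)
  | pnco (t : ATy)
  | half (t : ATy)

/-- The space that an argument type stands for. In a compact powerdomain, the empty set is the
element of `PUnit`, and it has distance `1` from the nonempty sets. -/
noncomputable def ATy.interp (D C : Obj.{u}) : ATy.{u} → Obj.{u}
  | .M X => ⟨X.X⟩
  | .D => D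
  | .C => C
  | .prod s t => ⟨(s.interp D C).X × (t.interp D C).X⟩
  | .sum s t => ⟨MSum (s.interp D C).X (t.interp D C).X⟩
  | .fn B t => ⟨B →ᵤ (t.interp D C).X⟩
  | .pco t => ⟨MSum PUnit.{u + 1} (NonemptyCompacts (t.interp D C).X)⟩
  | .pnco t => ⟨NonemptyCompacts (t.interp D C).X⟩
  | .half t => ⟨Half (t.interp D C).X⟩

/-- The subspace of an argument type for subsets `D'` of `D` and `C'` of `C`. -/
def ATy.inv {D C : Obj.{u}} (D' : Set D.X) (C' : Set C.X) : ∀ t : ATy.{u}, Set (t.interp D C).X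
  | .M _ => Set.univ
  | .D => D'
  | .C => C'
  | .prod s t => {x | x.1 ∈ s.inv D' C' ∧ x.2 ∈ t.inv D' C'}
  | .sum s t => {x | (∀ y, x = MSum.inl y → y ∈ s.inv D' C') ∧ ∀ y, x = MSum.inr y → y ∈ t.inv D' C'}
  | .fn _ t => {x | ∀ b, UniformFun.toFun x b ∈ t.inv D' C'}
  | .pco t => {x : MSum PUnit.{u + 1} (NonemptyCompacts (t.interp D C).X) |
      ∀ y, x = .inr y → ∀ z ∈ y, z ∈ t.inv D' C'}
  | .pnco t => {x : NonemptyCompacts (t.interp D C).X | ∀ z ∈ x, z ∈ t.inv D' C'}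
  | .half t => {x | x.val ∈ t.inv D' C'}

/-- The function `f` belongs to the space of the operator type `s →¹ t`, and `C'` is invariant
for `D'` under the operator `f`. -/
def Invariant {D C : Obj.{u}} (D' : Set D.X) (C' : Set C.X) (s t : ATy.{u})
    (f : (s.interp D C).X → (t.interp D C).X) : Prop :=
  (∀ x y, dist (f x) (f y) ≤ dist x y) ∧ ∀ x ∈ s.inv D' C', f x ∈ t.inv D' C'

/-- The names of the operators that are used in the definition of the denotational semantics. -/
inductive Op (n : ℕ) : Type
  | contRes | addSeq | addLMerge | addLSyn
  | res | seq | choice | merge | lmerge | lsyn | syn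
  | nedp (i : Fin (n + 1))
  | denRes | denSeq | denMerge | kd
  | cardU | cardG | opA

/-- The type of `Den`. -/
noncomputable def ATy.den : ATy.{u} := sum (M ⟨PUnit⟩) (half D)

/-- The type of an argument of each operator. -/
noncomputable def Op.dom (N A : Type u) {n : ℕ} : Op n → ATy.{u}
  | contRes => .prod .C (.M (.disc N))
  | addSeq | addLMerge | addLSyn => .prod .D .C
  | res => .prod .D (.M (.disc N))
  | seq | choice | merge | lmerge | lsyn | syn => .prod .D .D
  | nedp _ => .prod (.M ⟨PD A⟩) (.M ⟨PD A⟩)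
  | denRes => .prod .den (.M (.disc N))
  | denSeq | denMerge => .prod .den .den
  | kd => .prod (.M (.disc (Ident N)))
      (.prod (.M (.disc (Finset (Ident N)))) (.fn (Ident N) .den))
  | cardU | cardG => .C
  | opA => .prod (.M (.disc (Act N A n))) .C

/-- The type of the result of each operator. -/
noncomputable def Op.cod (A : Type u) {n : ℕ} : Op n → ATy.{u}
  | contRes | addSeq | addLMerge | addLSyn => .C
  | res | seq | choice | merge | lmerge | lsyn | syn => .D
  | nedp _ => .M ⟨PD A⟩
  | denRes | denSeq | denMerge | kd => .den
  | cardU => .M (.disc (ULift ℕ))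
  | cardG => .M (.disc (ULift Prop))
  | opA => .M ⟨PD A⟩

/-- The operators. -/
noncomputable def Op.eval {N A : Type u} {n : ℕ} (S : Solution N A n) (τ : A) : ∀ o : Op n,
    ((o.dom N A).interp ⟨S.D⟩ ⟨S.C⟩).X → ((o.cod A).interp ⟨S.D⟩ ⟨S.C⟩).X
  | contRes => fun x : S.C × Disc N => x.1.res x.2.val
  | addSeq => fun x : S.D × S.C => Cont.addSeq x.1 x.2
  | addLMerge => fun x : S.D × S.C => Cont.addLMerge x.1 x.2
  | addLSyn => fun x : S.D × S.C => Cont.addLSyn x.1 x.2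
  | res => fun x : S.D × Disc N => S.res x.1 x.2.val
  | seq => fun x : S.D × S.D => S.seq x.1 x.2
  | choice => fun x : S.D × S.D => S.choice τ x.1 x.2
  | merge => fun x : S.D × S.D => S.merge τ x.1 x.2
  | lmerge => fun x : S.D × S.D => S.lmerge x.1 x.2
  | lsyn => fun x : S.D × S.D => S.lsyn τ x.1 x.2
  | syn => fun x : S.D × S.D => S.syn τ x.1 x.2
  | nedp i => fun x : PD A × PD A => PD.nedp n τ i x.1 x.2
  | denRes => fun x : Den S.D × Disc N => S.denRes x.1 x.2.val
  | denSeq => fun x : Den S.D × Den S.D => S.denSeq x.1 x.2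
  | denMerge => fun x : Den S.D × Den S.D => S.denMerge τ x.1 x.2
  | kd => fun x : Disc (Ident N) × K N S.D =>
      S.kd τ x.2.1.val (UniformFun.toFun x.2.2) x.1.val
  | cardU => fun γ : S.C => (⟨⟨γ.cardU⟩⟩ : Disc (ULift.{u} ℕ))
  | cardG => fun γ : S.C => (⟨⟨γ.CardG⟩⟩ : Disc (ULift.{u} Prop))
  | opA => fun x : Disc (Act N A n) × S.C => S.opA τ x.1.val x.2

/-- The set `C'` is a class of denotable continuations for the denotational semantics: it is
invariant for `D^𝒟` under all operators used in the definition of `𝒟`. -/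
def IsDenotableClass {N A Y : Type u} {n : ℕ} (S : Solution N A n) (τ : A) (decl : Decl N A Y n)
    (C' : Set S.C) : Prop :=
  ∀ o : Op n, Invariant (D := ⟨S.D⟩) (C := ⟨S.C⟩) (S.denSet τ decl) C' (o.dom N A) (o.cod A)
    (o.eval S τ)


end CCSn

namespace CCSn

/-! ## Nonexpansive maps of several arguments -/

/-! The semantics is compositional, and every operator that produces a denotation or a continuation
has a syntactic counterpart. Hence the closure conditions can be checked on statements and
resumptions instead of on functions.

For the operators on $D$, restriction, sequential composition, choice and the two left merges are
statement constructors, and the equation $\Psi(\mathcal D)=\mathcal D$ (`Psi_den`) says that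
$\mathcal D$ turns each constructor into its operator. The operators $|$ and $\parallel$ are built
from these. So applying an operator to denotations of statements gives the denotation of a compound
statement. The extensions to $Den$ inherit this, because $\phi_E$ is fixed by restriction and
neutral for the other two, and `kd` inherits it by induction along its recursion: every value it
returns is assembled from $\phi_E$ and values of $\theta$ with the operators on $Den$.

For the operators on $Cont$, the inductive clauses of `Res` imitate $\tilde\backslash$ and the three
$add$ operators, and `sem` commutes with them. The one point that needs an argument is that
interpreting an updated bag is the same as updating the interpreted bag (`semR_upd`). The remaining
operators take values in $P_D$, $\mathbb N$ or $Bool$, domains that do not mention $D$ or $Cont$.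
Their invariance condition on values is empty, and only nonexpansiveness counts.

For nonexpansiveness, elements of $D$ enter a continuation scaled by $\frac12$, so the sharper
estimates with half distances are more than enough. A discrete argument is harmless: all distances
are at most $1$, and points at distance less than $1$ agree in every discrete component. This
reduces a map with a discrete parameter to its sections, and it makes the cardinality operators
locally constant.

The claim on lengths is a counting invariant of resumptions, `Res.length_tail`: $f$ and $\mu$ always
have the same length. A synchronization prefix adds one element to both, the execution of an action
removes one from both, and the other clauses touch neither length. Thus $len(f)+|u|<n$ bounds the
length of $\mu$ strictly by $n$. -/

theorem UMet.dist_le_of_eq_of_lt {X Y : Type u} [MetricSpace X] [MetricSpace Y] [UMet Y]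
    (f : X → Y) (h : ∀ x y, dist x y < 1 → f x = f y) (x y : X) :
    dist (f x) (f y) ≤ dist x y := by
  -- Below distance $1$ the values coincide by assumption. From distance $1$ on, the bound by $1$ in
  -- the target space suffices.
  rcases lt_or_ge (dist x y) 1 with hd | hd
  · rw [h x y hd, dist_self]; exact dist_nonneg
  · exact (UMet.le_one _ _).trans hd

/-- The product carries the maximum metric, so two pairs at distance less than $1$ have the same
discrete component, and only the section of `f` at that component matters. Pairs at distance at
least $1$ impose no condition. -/
theorem dist_le_of_disc_right {X B Y : Type u} [MetricSpace X] [MetricSpace Y] [UMet Y]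
    (f : X × Disc B → Y) (h : ∀ b x y, dist (f (x, b)) (f (y, b)) ≤ dist x y)
    (x y : X × Disc B) : dist (f x) (f y) ≤ dist x y := by
  rcases lt_or_ge (dist x y) 1 with hd | hd
  swap
  · exact (UMet.le_one _ _).trans hd
  obtain ⟨x, b⟩ := x
  obtain ⟨y, c⟩ := y
  rw [Prod.dist_eq] at hd ⊢
  obtain rfl : b = c := Disc.eq_of_dist_lt ((le_max_right _ _).trans_lt hd)
  exact (h b x y).trans (le_max_left _ _)

theorem dist_le_of_disc_left {X B Y : Type u} [MetricSpace X] [MetricSpace Y] [UMet Y]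
    (f : Disc B × X → Y) (h : ∀ b x y, dist (f (b, x)) (f (b, y)) ≤ dist x y)
    (x y : Disc B × X) : dist (f x) (f y) ≤ dist x y := by
  rcases lt_or_ge (dist x y) 1 with hd | hd
  swap
  · exact (UMet.le_one _ _).trans hd
  obtain ⟨b, x⟩ := x
  obtain ⟨c, y⟩ := y
  rw [Prod.dist_eq] at hd ⊢
  obtain rfl : b = c := Disc.eq_of_dist_lt ((le_max_left _ _).trans_lt hd)
  exact (h b x y).trans (le_max_right _ _)

/-! ## Resumptions -/

/-- The statements in $f$ are the partners that still have to join the current synchronization, and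
the tail $\mu$ holds their identifiers. The clause `syn` extends both lists by one, `act` drops the
head of both, and `res`, `seq` and `par` only change the leading identifier, which is not counted.
-/
theorem Res.length_tail {N A Y : Type u} {n : ℕ} {f : BList (Stmt N A Y n) n} {u : ISet N A n}
    {μ : Ids N n} {k : KRes N A Y n} (h : Res f u μ k) : μ.tail.length = f.val.length := by
  induction h with
  | init f u μ hf hu hh ht => rw [hf, ht]; rfl
  | act x a f f' u u' μ μ' k _ hf _ _ ht ih => rw [hf, ht] at ih; simpa using ih
  | res c f u μ μ' k _ _ ht ih => rw [ht, ih]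
  | seq x f u μ μ' k _ _ ht ih => rw [ht, ih]
  | par x f u μ μ' k _ _ ht ih => rw [ht, ih]
  | syn x f f' u μ μ' k _ _ hf _ ht ih => rw [hf, ht]; simp [ih]

namespace Solution
variable {N A Y : Type u} {n : ℕ} (S : Solution N A n) (τ : A) (decl : Decl N A Y n)

theorem hasRoom_of_mem_contSet {γ : S.C} (h : γ ∈ S.contSet τ decl) (hc : γ.CardG) :
    γ.HasRoom := by
  obtain ⟨f, u, μ, k, hr, rfl⟩ := h
  simp only [Cont.CardG, sem, List.length_map] at hc
  simp only [Cont.HasRoom, sem, hr.length_tail]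
  -- The cardinality of the interaction set is only a natural number here. Dropping it from
  -- $len(f)+|u|<n$ leaves the bound on the tail.
  omega

/-! ## The set of denotations is closed under the semantic operators -/

section denSet
variable {S τ decl} {φ₁ φ₂ : S.D}

/-- The witness is the compound statement. The fixed point equation, unfolded at its outermost
constructor, says that its denotation is the operator applied to the denotations of the parts. The
next four lemmas follow the same pattern. -/
theorem res_mem_denSet (h : φ₁ ∈ S.denSet τ decl) (c : N) : S.res φ₁ c ∈ S.denSet τ decl := by
  obtain ⟨x, rfl⟩ := h
  exact ⟨.res x c, by rw [← S.Psi_den τ decl, Psi]⟩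

theorem seq_mem_denSet (h₁ : φ₁ ∈ S.denSet τ decl) (h₂ : φ₂ ∈ S.denSet τ decl) :
    S.seq φ₁ φ₂ ∈ S.denSet τ decl := by
  obtain ⟨x₁, rfl⟩ := h₁
  obtain ⟨x₂, rfl⟩ := h₂
  -- The clause of `Psi` for this constructor uses $\Psi(S)$ on the first argument and $S$ itself on
  -- the second. At the fixed point these agree: the left side is expanded once and then folded back
  -- to $\mathcal D$. Working on the left side only keeps the right side in terms of $\mathcal D$.
  exact ⟨.seq x₁ x₂, by conv_lhs => rw [← S.Psi_den τ decl, Psi, S.Psi_den τ decl]⟩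

theorem choice_mem_denSet (h₁ : φ₁ ∈ S.denSet τ decl) (h₂ : φ₂ ∈ S.denSet τ decl) :
    S.choice τ φ₁ φ₂ ∈ S.denSet τ decl := by
  obtain ⟨x₁, rfl⟩ := h₁
  obtain ⟨x₂, rfl⟩ := h₂
  exact ⟨.choice x₁ x₂, by conv_lhs => rw [← S.Psi_den τ decl, Psi, S.Psi_den τ decl]⟩

theorem lmerge_mem_denSet (h₁ : φ₁ ∈ S.denSet τ decl) (h₂ : φ₂ ∈ S.denSet τ decl) :
    S.lmerge φ₁ φ₂ ∈ S.denSet τ decl := by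
  obtain ⟨x₁, rfl⟩ := h₁
  obtain ⟨x₂, rfl⟩ := h₂
  exact ⟨.lmerge x₁ x₂, by conv_lhs => rw [← S.Psi_den τ decl, Psi, S.Psi_den τ decl]⟩

theorem lsyn_mem_denSet (h₁ : φ₁ ∈ S.denSet τ decl) (h₂ : φ₂ ∈ S.denSet τ decl) :
    S.lsyn τ φ₁ φ₂ ∈ S.denSet τ decl := by
  obtain ⟨x₁, rfl⟩ := h₁
  obtain ⟨x₂, rfl⟩ := h₂
  exact ⟨.lsyn x₁ x₂, by conv_lhs => rw [← S.Psi_den τ decl, Psi, S.Psi_den τ decl]⟩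

theorem syn_mem_denSet (h₁ : φ₁ ∈ S.denSet τ decl) (h₂ : φ₂ ∈ S.denSet τ decl) :
    S.syn τ φ₁ φ₂ ∈ S.denSet τ decl :=
  choice_mem_denSet (lsyn_mem_denSet h₁ h₂) (lsyn_mem_denSet h₂ h₁)

/-- The operator groups its four summands as $(a\oplus b)\oplus(c\oplus d)$, whereas the clause of
$\Psi$ for $x_1\parallel x_2$ nests them to the left. Composing the closure lemmas makes the witness
a sum of left merges instead of $x_1\parallel x_2$, so that associativity of $\oplus$ is not needed.
-/
theorem merge_mem_denSet (h₁ : φ₁ ∈ S.denSet τ decl) (h₂ : φ₂ ∈ S.denSet τ decl) :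
    S.merge τ φ₁ φ₂ ∈ S.denSet τ decl :=
  choice_mem_denSet (choice_mem_denSet (lmerge_mem_denSet h₁ h₂) (lmerge_mem_denSet h₂ h₁))
    (syn_mem_denSet h₁ h₂)

end denSet

/-! ## Closure in `Den` -/

/-- `Den^𝒟`: the element `φ_E` and the denotations of statements. -/
def denESet : Set (Den S.D) :=
  {d | (∀ e, d = .inl e → e ∈ Set.univ) ∧ ∀ φ, d = .inr φ → φ.val ∈ S.denSet τ decl}

section denESet
variable {S τ decl}

theorem inl_mem_denESet (e : PUnit.{u + 1}) :
    (MSum.inl e : Den S.D) ∈ S.denESet τ decl :=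
  ⟨fun _ _ => trivial, fun _ h => (nomatch h)⟩

/-- The set `denESet` is phrased so that it unfolds to the same condition as `ATy.inv` at the type
`ATy.den`. This equivalence gives the usable form of the condition on the second summand. -/
theorem inr_mem_denESet {φ : Half S.D} :
    (MSum.inr φ : Den S.D) ∈ S.denESet τ decl ↔ φ.val ∈ S.denSet τ decl :=
  ⟨fun h => h.2 φ rfl, fun h => ⟨fun _ h' => (nomatch h'), fun _ h' => by cases h'; exact h⟩⟩

theorem denRes_mem_denESet {d : Den S.D} (h : d ∈ S.denESet τ decl) (c : N) :
    S.denRes d c ∈ S.denESet τ decl := by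
  cases d with
  | inl e => exact h
  | inr φ => exact inr_mem_denESet.2 (res_mem_denSet (inr_mem_denESet.1 h) c)

theorem denSeq_mem_denESet {d e : Den S.D} (h : d ∈ S.denESet τ decl)
    (h' : e ∈ S.denESet τ decl) : S.denSeq d e ∈ S.denESet τ decl := by
  cases d with
  | inl _ => exact h'
  | inr φ =>
    cases e with
    | inl _ => exact h
    | inr ψ =>
      exact inr_mem_denESet.2 (seq_mem_denSet (inr_mem_denESet.1 h) (inr_mem_denESet.1 h'))

theorem denMerge_mem_denESet {d e : Den S.D} (h : d ∈ S.denESet τ decl)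
    (h' : e ∈ S.denESet τ decl) : S.denMerge τ d e ∈ S.denESet τ decl := by
  cases d with
  | inl _ => exact h'
  | inr φ =>
    cases e with
    | inl _ => exact h
    | inr ψ =>
      exact inr_mem_denESet.2 (merge_mem_denSet (inr_mem_denESet.1 h) (inr_mem_denESet.1 h'))

/-- The set $\pi$ only decides which branch is taken. Whatever it is, even if no resumption produces
it, each branch returns $\phi_E$, a value of $\theta$, or an operator on $Den$ applied to such
values and recursive results. -/
theorem kd_mem_denESet (π : Finset (Ident N)) {θ : Ident N → Den S.D}
    (h : ∀ β, θ β ∈ S.denESet τ decl) (α : Ident N) : S.kd τ π θ α ∈ S.denESet τ decl := by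
  -- The induction principle of the recursion supplies hypotheses at the longer identifiers. In the
  -- sequential case the right component is read off directly as $\theta(\alpha(;\bullet))$, so that
  -- `h` replaces a second hypothesis there.
  induction α using kd.induct (π := π) with
  | case1 α h₀ => rw [kd, dif_pos h₀]; exact inl_mem_denESet _
  | case2 α h₀ h₁ => rw [kd, dif_neg h₀, dif_pos h₁]; exact h α
  | case3 α h₀ h₁ h₂ ih =>
    rw [kd, dif_neg h₀, dif_neg h₁, dif_pos h₂]; exact denRes_mem_denESet ih _
  | case4 α h₀ h₁ h₂ h₃ ih =>
    rw [kd, dif_neg h₀, dif_neg h₁, dif_neg h₂, if_pos h₃]; exact denSeq_mem_denESet ih (h _)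
  | case5 α h₀ h₁ h₂ h₃ ih₁ ih₂ =>
    rw [kd, dif_neg h₀, dif_neg h₁, dif_neg h₂, if_neg h₃]; exact denMerge_mem_denESet ih₁ ih₂

end denESet

/-! ## The set of denotable continuations is closed under the operators on continuations -/

section contSet
variable {S τ decl} {γ : S.C} {φ : S.D}

open Classical in
-- Interpretation acts pointwise on the second component and leaves the set of identifiers alone, so
-- it commutes with $k[\alpha\mapsto x]$, where the new entry becomes $\mathcal D(x)$. This is what
-- lets a clause of `Res` be matched with $add_;$ and $add_{\lfloor\!\lfloor}$.
theorem semR_upd (k : KRes N A Y n) (α : Ident N) (x : Stmt N A Y n) :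
    ((⟨(k.upd α x).1⟩, UniformFun.ofFun fun β => S.semR τ decl ((k.upd α x).2 β)) : K N S.D) =
      K.upd (⟨k.1⟩, UniformFun.ofFun fun β => S.semR τ decl (k.2 β)) α
        (.inr ⟨S.den τ decl x⟩) := by
  refine Prod.ext rfl (funext fun β => ?_)
  change S.semR τ decl (Function.update k.2 α (some x) β) =
    Function.update (fun β => S.semR τ decl (k.2 β)) α (.inr ⟨S.den τ decl x⟩) β
  rcases eq_or_ne β α with rfl | e
  · rw [Function.update_self, Function.update_self]; rfl
  · rw [Function.update_of_ne e, Function.update_of_ne e]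

theorem contRes_mem_contSet (h : γ ∈ S.contSet τ decl) (c : N) :
    γ.res c ∈ S.contSet τ decl := by
  obtain ⟨f, u, μ, k, hr, rfl⟩ := h
  -- The new leading identifier is determined by unification with the clause of `Res`. Since `sem`
  -- copies identifiers unchanged, both continuations then agree by definition.
  exact ⟨f, u, ⟨_, μ.tail, μ.length_le⟩, k, .res c f u μ _ k hr rfl rfl, rfl⟩

theorem addSeq_mem_contSet (hφ : φ ∈ S.denSet τ decl) (h : γ ∈ S.contSet τ decl) :
    Cont.addSeq φ γ ∈ S.contSet τ decl := by
  obtain ⟨x, rfl⟩ := hφ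
  obtain ⟨f, u, μ, k, hr, rfl⟩ := h
  refine ⟨f, u, ⟨_, μ.tail, μ.length_le⟩, _, .seq x f u μ _ k hr rfl rfl, ?_⟩
  conv_rhs => rw [sem, semR_upd]
  rfl

theorem addLMerge_mem_contSet (hφ : φ ∈ S.denSet τ decl) (h : γ ∈ S.contSet τ decl) :
    Cont.addLMerge φ γ ∈ S.contSet τ decl := by
  obtain ⟨x, rfl⟩ := hφ
  obtain ⟨f, u, μ, k, hr, rfl⟩ := h
  refine ⟨f, u, ⟨_, μ.tail, μ.length_le⟩, _, .par x f u μ _ k hr rfl rfl, ?_⟩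
  conv_rhs => rw [sem, semR_upd]
  rfl

theorem addLSyn_mem_contSet (hφ : φ ∈ S.denSet τ decl) (h : γ ∈ S.contSet τ decl) :
    Cont.addLSyn φ γ ∈ S.contSet τ decl := by
  unfold Cont.addLSyn
  -- If the guard fails, the operator returns the given continuation, which is in the class by
  -- hypothesis. Only the guarded case needs a new resumption.
  split_ifs with hc
  swap
  · exact h
  obtain ⟨x, rfl⟩ := hφ
  obtain ⟨f, u, μ, k, hr, rfl⟩ := h
  have hl : f.val.length + u.val.card < n := by
    simpa [Cont.CardG, Cont.cardU, sem] using hc.1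
  -- The guard yields both length bounds: the strict inequality for $len(f)$ leaves place for $x$,
  -- and `hc.2`, a strict bound on the length of $\mu$, is by definition the weak bound for the tail
  -- with one more identifier.
  exact ⟨⟨x :: f.val, by rw [List.length_cons]; omega⟩, u, ⟨_, _ :: μ.tail, hc.2⟩, k,
    .syn x f _ u μ _ k hr hl rfl rfl rfl, rfl⟩

end contSet

/-! ## Nonexpansiveness of the operators -/

/-- The recursion branches on $\pi$ and $\alpha$ alone. Since $\pi$ is discrete, it may be taken
equal on both sides; then both evaluations follow the same tree and differ only in the values of
$\theta$. -/
theorem dist_kd_le (α : Ident N) (κ κ' : K N S.D) :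
    dist (S.kd τ κ.1.val (UniformFun.toFun κ.2) α)
      (S.kd τ κ'.1.val (UniformFun.toFun κ'.2) α) ≤ dist κ κ' :=
  dist_le_of_disc_left (fun κ : K N S.D => S.kd τ κ.1.val (UniformFun.toFun κ.2) α)
    (fun π _ _ => S.dist_kd τ π.val _ _ α dist_nonneg fun β =>
      (UniformFun.dist_le dist_nonneg).1 le_rfl β) κ κ'

theorem isDenotableClass_contSet : IsDenotableClass S τ decl (S.contSet τ decl) := by
  -- An argument that is stored in a continuation contributes only half of its distance. Invariance
  -- asks for the weaker estimate without this factor.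
  have half : ∀ φ φ' : S.D, dist φ φ' / 2 ≤ dist φ φ' := fun φ φ' =>
    half_le_self dist_nonneg
  intro o
  cases o with
  | contRes =>
    exact ⟨dist_le_of_disc_right (fun x : S.C × Disc N => x.1.res x.2.val)
      fun c γ γ' => Cont.dist_res γ γ' c.val, fun x hx => contRes_mem_contSet hx.1 _⟩
  | addSeq =>
    exact ⟨fun (x y : S.D × S.C) => (Cont.dist_addSeq x.1 y.1 x.2 y.2).trans
      (max_le_max (half _ _) le_rfl), fun x hx => addSeq_mem_contSet hx.1 hx.2⟩
  | addLMerge =>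
    exact ⟨fun (x y : S.D × S.C) => (Cont.dist_addLMerge x.1 y.1 x.2 y.2).trans
      (max_le_max (half _ _) le_rfl), fun x hx => addLMerge_mem_contSet hx.1 hx.2⟩
  | addLSyn =>
    exact ⟨fun (x y : S.D × S.C) => (Cont.dist_addLSyn x.1 y.1 x.2 y.2).trans
      (max_le_max (half _ _) le_rfl), fun x hx => addLSyn_mem_contSet hx.1 hx.2⟩
  | res =>
    exact ⟨dist_le_of_disc_right (fun x : S.D × Disc N => S.res x.1 x.2.val)
      fun c φ φ' => S.dist_res φ φ' c.val, fun x hx => res_mem_denSet hx.1 _⟩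
  | seq =>
    exact ⟨fun (x y : S.D × S.D) => (S.dist_seq x.1 x.2 y.1 y.2).trans
      (max_le_max le_rfl (half _ _)), fun x hx => seq_mem_denSet hx.1 hx.2⟩
  | choice =>
    exact ⟨fun (x y : S.D × S.D) => S.dist_choice_le τ x.1 x.2 y.1 y.2,
      fun x hx => choice_mem_denSet hx.1 hx.2⟩
  | merge =>
    exact ⟨fun (x y : S.D × S.D) => S.dist_merge_le τ (le_max_left _ _) (le_max_right _ _),
      fun x hx => merge_mem_denSet hx.1 hx.2⟩
  | lmerge =>
    exact ⟨fun (x y : S.D × S.D) => (S.dist_lmerge x.1 x.2 y.1 y.2).trans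
      (max_le_max le_rfl (half _ _)), fun x hx => lmerge_mem_denSet hx.1 hx.2⟩
  | lsyn =>
    exact ⟨fun (x y : S.D × S.D) => (S.dist_lsyn τ x.1 x.2 y.1 y.2).trans
      (max_le_max le_rfl (half _ _)), fun x hx => lsyn_mem_denSet hx.1 hx.2⟩
  | syn =>
    refine ⟨fun (x y : S.D × S.D) => ?_, fun x hx => syn_mem_denSet hx.1 hx.2⟩
    refine (S.dist_choice_le τ _ _ _ _).trans (max_le ?_ ?_)
    · exact (S.dist_lsyn τ x.1 x.2 y.1 y.2).trans (max_le_max le_rfl (half _ _))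
    · exact (S.dist_lsyn τ x.2 x.1 y.2 y.1).trans
        -- In the second summand the arguments are exchanged, so the maximum comes out in the
        -- opposite order.
        ((max_le_max le_rfl (half _ _)).trans_eq (max_comm _ _))
  | nedp i =>
    exact ⟨fun (x y : PD A × PD A) => PD.dist_union τ (n - i) x.1 x.2 y.1 y.2,
      -- The result type is a fixed metric domain, whose invariant subset is the whole space. The
      -- same holds for the two cardinality operators and for $op_A$.
      fun _ _ => trivial⟩
  | denRes =>
    exact ⟨dist_le_of_disc_right (fun x : Den S.D × Disc N => S.denRes x.1 x.2.val)
      fun c d d' => S.dist_denRes le_rfl c.val, fun x hx => denRes_mem_denESet hx.1 _⟩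
  | denSeq =>
    exact ⟨fun (x y : Den S.D × Den S.D) => S.dist_denSeq (le_max_left _ _) (le_max_right _ _),
      fun x hx => denSeq_mem_denESet hx.1 hx.2⟩
  | denMerge =>
    exact ⟨fun (x y : Den S.D × Den S.D) =>
      S.dist_denMerge τ (le_max_left _ _) (le_max_right _ _),
      fun x hx => denMerge_mem_denESet hx.1 hx.2⟩
  | kd =>
    exact ⟨dist_le_of_disc_left (fun x : Disc (Ident N) × K N S.D =>
        S.kd τ x.2.1.val (UniformFun.toFun x.2.2) x.1.val)
      fun α κ κ' => S.dist_kd_le τ α.val κ κ',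
      fun x hx => kd_mem_denESet _ (fun β => hx.2.2 β) _⟩
  | cardU =>
    exact ⟨UMet.dist_le_of_eq_of_lt (fun γ : S.C => (⟨⟨γ.cardU⟩⟩ : Disc (ULift.{u} ℕ)))
      -- Continuations at distance less than $1$ have the same interaction set and sequences
      -- $\varphi$ of the same length, so both cardinality operators are constant on such balls.
      fun γ γ' h => by rw [(Cont.cardG_congr h).1.1], fun _ _ => trivial⟩
  | cardG =>
    exact ⟨UMet.dist_le_of_eq_of_lt (fun γ : S.C => (⟨⟨γ.CardG⟩⟩ : Disc (ULift.{u} Prop)))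
      fun γ γ' h => by rw [propext (Cont.cardG_congr h).1.2], fun _ _ => trivial⟩
  | opA =>
    exact ⟨dist_le_of_disc_left (fun x : Disc (Act N A n) × S.C => S.opA τ x.1.val x.2)
      fun a γ γ' => S.dist_opA τ a.val γ γ', fun _ _ => trivial⟩

end Solution

end CCSn

/-- The predicate `HasRoom` counts only the tail $\mu$: fewer than $n$ elements there means at most
$n$ in $\alpha:\mu$. Together with `CardG` it is exactly the guard of `Cont.addLSyn`, so for these
continuations $add_\lfloor$ is given by its explicit formula. -/
theorem mainTheorem6 {N A Y : Type u} [Countable N] (τ : A) (n : ℕ) (hn : 0 < n)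
    (decl : CCSn.Decl N A Y n) (S : CCSn.Solution N A n) :
    CCSn.IsDenotableClass S τ decl (S.contSet τ decl) ∧
      ∀ γ ∈ S.contSet τ decl, γ.CardG → γ.HasRoom :=
  ⟨S.isDenotableClass_contSet τ decl, fun _ h hc => S.hasRoom_of_mem_contSet τ decl h hc⟩
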